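/- Let $\alpha>-1/2$ and $\beta\in\mathbb R$. For $C\in\mathbb C$ and $|z|=1$, $z\neq1$, let $$w(z)=C\,(1-z)^{\alpha+i\beta}(1-1/z)^{\alpha-i\beta},$$ with principal powers, and let $w_m=\frac1{2\pi i}\int_{|z|=1}w(z)\,z^{-m-1}\,dz$ for $m\in\mathbb Z$. There is exactly one constant $C$ for which $w_0=\frac1{2\pi}$. For this $C$, there is exactly one sequence of polynomials $\phi_n(z)=k_nz^n+\cdots$ with $k_n>0$ $(n=0,1,2,\dots)$ such that $$\int_{|z|=1}\phi_m(z)\overline{\phi_n(z)}\,w(z)\,\frac{dz}{iz}=\delta_{m,n}\qquad(m,n\ge0),$$ and the Toeplitz determinants $\Delta_n=\det(w_{j-k})_{j,k=0}^{n-1}$ satisfy, for every $n\ge0$ (with $\Delta_0=1$), $$\Delta_n=\prod_{j=0}^{n-1}\frac1{2\pi k_j^2}=C^n\,\frac{G(n+1)\,G(n+2\alpha+1)\,G(\alpha+i\beta+1)\,G(\alpha-i\beta+1)}{G(2\alpha+1)\,G(n+\alpha+i\beta+1)\,G(n+\alpha-i\beta+1)},$$ where $G$ is the Barnes $G$-function,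 that is, the entire function $$G(s+1)=(2\pi)^{s/2}\exp\Bigl(-\tfrac{s+(1+\gamma)s^2}{2}\Bigr)\prod_{k=1}^{\infty}\Bigl(1+\frac sk\Bigr)^k\exp\Bigl(\frac{s^2}{2k}-s\Bigr)$$ and $\gamma$ is Euler's constant. -/

import Mathlib

open Complex

/-- The Barnes function at `s + 1`, by its Weierstrass product
`G(s+1) = (2π)^{s/2} exp(-(s + (1+γ)s²)/2) ∏_{k ≥ 1} (1 + s/k)^k exp(s²/(2k) - s)`
(the index `k : ℕ` below is shifted by one). -/
noncomputable def barnesGAddOne (s : ℂ) : ℂ :=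
  ((2 * Real.pi : ℝ) : ℂ) ^ (s / 2)
    * exp (-(s + (1 + (Real.eulerMascheroniConstant : ℂ)) * s ^ 2) / 2)
    * ∏' k : ℕ, (1 + s / ((k : ℂ) + 1)) ^ (k + 1) * exp (s ^ 2 / (2 * ((k : ℂ) + 1)) - s)

/-- The Barnes `G`-function. -/
noncomputable def barnesG (z : ℂ) : ℂ := barnesGAddOne (z - 1)

/-- The pure Fisher-Hartwig symbol `w(z) = C (1 - z)^{α + iβ} (1 - 1/z)^{α - iβ}`, with principal
powers: for `|z| = 1`, `z ≠ 1`, both bases lie in the open right half plane, and the first (second)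
factor is the boundary value of the branch that is analytic inside (outside) the circle
and equal to one at `0` (at `∞`). -/
noncomputable def fisherHartwigSymbol (C : ℂ) (α β : ℝ) (z : ℂ) : ℂ :=
  C * (1 - z) ^ ((α : ℂ) + I * β) * (1 - 1 / z) ^ ((α : ℂ) - I * β)

/-- The Fourier coefficient `w_m = (1 / 2πi) ∮_{|z| = 1} w(z) z^{-(m+1)} dz`. -/
noncomputable def symbolCoeff (w : ℂ → ℂ) (m : ℤ) : ℂ :=
  (2 * Real.pi * I)⁻¹ * ∮ z in C(0, 1), w z / z ^ (m + 1)

/-- The Toeplitz determinant `Δ_n[w] = det (w_{j-k})_{j,k = 0}^{n-1}`. -/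
noncomputable def toeplitzDet (w : ℂ → ℂ) (n : ℕ) : ℂ :=
  (Matrix.of fun j k : Fin n => symbolCoeff w ((j : ℤ) - (k : ℤ))).det

/-- `φ 0, φ 1, …` are orthonormal polynomials on the unit circle for the weight `w`: `φ n` has
degree `n` and a positive leading coefficient `k_n`, and
`∮_{|z| = 1} φ_m(z) conj(φ_n(z)) w(z) dz / (iz) = δ_{m,n}`. -/
structure IsOrthonormalPolynomials (w : ℂ → ℂ) (φ : ℕ → Polynomial ℂ) : Prop where
  natDegree_eq : ∀ n, (φ n).natDegree = n
  leadingCoeff_re_pos : ∀ n, 0 < (φ n).leadingCoeff.re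
  leadingCoeff_im_eq_zero : ∀ n, (φ n).leadingCoeff.im = 0
  orthonormal : ∀ m n,
    (∮ z in C(0, 1), (φ m).eval z * (starRingEnd ℂ) ((φ n).eval z) * w z / (I * z))
      = if m = n then 1 else 0

/-! At `z = e^{iθ}`, `0 < θ < 2π`, the symbol is `C` times the positive weight `(2 sin(θ/2))^{2α}
e^{-β(θ-π)}`, so `w_0 = 1/(2π)` forces `C = 1/J` with `J > 0` the total mass. Everything else is
explicit. Write `a = α + iβ`, `b = α - iβ`.

Moments. Integrating the derivative of `(1-z) z^{-m}` times the weight gives a two-term recurrence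
in `m`, so all moments follow from the zeroth (`circleMoment_eq`). Since `|1-z|² = 2 - z - 1/z`, the
same recurrence relates the zeroth moments for `α` and `α + 1`. Hence the zeroth moment divided by
its conjectured Gamma quotient is 1-periodic in `α`, and its value `2π` is found by letting `α → ∞`:
the mass concentrates at `θ = π`, and Gamma asymptotics cancel the limit (`normalizedMass_eq`).

Orthogonal polynomials. They are defined by the Szegő recurrence with guessed reflection
coefficients. Induction on the degree gives closed forms for the pairings of the polynomial and of
its reversal with every `z^k`, `k ∈ ℤ` (`monomialPairing_szegoPair`). A factor `∏_{i<n} (i - k)`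
shows orthogonality for `0 ≤ k < n`, and `k = n` gives the squared norm `h_n = 2π n! Γ(2α+1+n) /
|Γ(a+1+n)|²`.

Determinants. The Toeplitz matrix is `1/(2π)` times the Gram matrix of the monomials, which the
triangular coefficient matrix of the `φ_j` reduces to the identity (`IsOrthonormalFor.det_gram`). So
`Δ_n = ∏ C h_j/(2π)`, and `G(z+1) = Γ(z) G(z)`, derived here from the Weierstrass product, turns
this into Barnes functions (`prod_monicNormSq_eq_barnesG`). -/

open Filter Topology

/-! ### The Barnes function: convergence, nonvanishing, functional equation. -/

/-- The `k`-th factor of the Weierstrass product of `barnesGAddOne s`. -/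
noncomputable def barnesFactor (s : ℂ) (k : ℕ) : ℂ :=
  (1 + s / ((k : ℂ) + 1)) ^ (k + 1) * exp (s ^ 2 / (2 * ((k : ℂ) + 1)) - s)

lemma norm_log_one_add_sub_add_le {x : ℂ} (hx : ‖x‖ ≤ 1 / 2) :
    ‖log (1 + x) - x + x ^ 2 / 2‖ ≤ ‖x‖ ^ 3 := by
  have h := norm_log_sub_logTaylor_le 2 (z := x) (by linarith)
  have e : logTaylor 3 x = x - x ^ 2 / 2 := by
    simp [logTaylor, Finset.sum_range_succ]; ring
  rw [show (2 : ℕ) + 1 = 3 from rfl, e] at h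
  have e2 : log (1 + x) - x + x ^ 2 / 2 = log (1 + x) - (x - x ^ 2 / 2) := by ring
  rw [e2]
  refine h.trans ?_
  have h1 : (1 - ‖x‖)⁻¹ ≤ 2 := by
    rw [inv_le_comm₀ (by linarith) (by norm_num)]; linarith
  have h0 : 0 ≤ ‖x‖ ^ 3 := by positivity
  have h2 : ‖x‖ ^ 3 * (1 - ‖x‖)⁻¹ ≤ ‖x‖ ^ 3 * 2 := mul_le_mul_of_nonneg_left h1 h0
  push_cast
  linarith

/-- With `x = s/(k+1)` the factor is `exp((k+1)(log(1+x) - x + x²/2))`, whose exponent is a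
third-order Taylor remainder times `k+1`, hence `O(1/k²)`. The two lower bounds on `k` keep `‖x‖ ≤
1/2` and the exponent at most 1 in norm. -/
lemma norm_barnesFactor_sub_one_le (s : ℂ) {k : ℕ} (hk : 2 * ‖s‖ ≤ k + 1)
    (hk' : ‖s‖ ^ 3 ≤ k + 1) :
    ‖barnesFactor s k - 1‖ ≤ 2 * ‖s‖ ^ 3 * (1 / ((k : ℝ) + 1) ^ 2) := by
  have hpos : (0 : ℝ) < (k : ℝ) + 1 := by positivity
  have hne : (k : ℂ) + 1 ≠ 0 := by exact_mod_cast k.succ_ne_zero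
  have hnorm : ‖(k : ℂ) + 1‖ = (k : ℝ) + 1 := by
    have : ((k : ℂ) + 1) = ((k + 1 : ℕ) : ℂ) := by push_cast; rfl
    rw [this, norm_natCast]; push_cast; rfl
  set x : ℂ := s / ((k : ℂ) + 1) with hx
  have hxn : ‖x‖ = ‖s‖ / (k + 1) := by rw [hx, norm_div, hnorm]
  have hx2 : ‖x‖ ≤ 1 / 2 := by
    rw [hxn, div_le_iff₀ hpos]; linarith
  have h1x : 1 + x ≠ 0 := by
    intro h
    have : x = -1 := by linear_combination h
    rw [this] at hx2; norm_num at hx2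
  set E : ℂ := ((k : ℂ) + 1) * (log (1 + x) - x + x ^ 2 / 2) with hE
  have hfac : barnesFactor s k = exp E := by
    have hE' : E = ((k + 1 : ℕ) : ℂ) * log (1 + x) + (s ^ 2 / (2 * ((k : ℂ) + 1)) - s) := by
      rw [hE, hx]; push_cast; field_simp; ring
    rw [hE', exp_add, exp_nat_mul, exp_log h1x, barnesFactor]
  have hEn : ‖E‖ ≤ ‖s‖ ^ 3 * (1 / ((k : ℝ) + 1) ^ 2) := by
    rw [hE, norm_mul, hnorm]
    calc ((k : ℝ) + 1) * ‖log (1 + x) - x + x ^ 2 / 2‖ ≤ ((k : ℝ) + 1) * ‖x‖ ^ 3 :=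
          mul_le_mul_of_nonneg_left (norm_log_one_add_sub_add_le hx2) hpos.le
      _ = ‖s‖ ^ 3 * (1 / ((k : ℝ) + 1) ^ 2) := by rw [hxn]; field_simp
  have hE1 : ‖E‖ ≤ 1 := by
    refine hEn.trans ?_
    rw [mul_one_div, div_le_one (by positivity)]
    nlinarith
  rw [hfac]
  refine (norm_exp_sub_one_le hE1).trans ?_
  linarith

lemma summable_norm_barnesFactor_sub_one (s : ℂ) :
    Summable fun k => ‖barnesFactor s k - 1‖ := by
  have hs : Summable fun k : ℕ => 2 * ‖s‖ ^ 3 * (1 / ((k : ℝ) + 1) ^ 2) := by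
    refine Summable.mul_left _ ?_
    have := (summable_nat_add_iff 1).2 (Real.summable_one_div_nat_pow (p := 2).2 (by norm_num))
    simpa using this
  refine Summable.of_norm_bounded_eventually_nat hs ?_
  obtain ⟨N, hN⟩ := exists_nat_ge (max (2 * ‖s‖) (‖s‖ ^ 3))
  filter_upwards [eventually_ge_atTop N] with k hk
  have hk' : (N : ℝ) ≤ k := by exact_mod_cast hk
  rw [norm_norm]
  exact norm_barnesFactor_sub_one_le s (by linarith [le_max_left (2 * ‖s‖) (‖s‖ ^ 3)])
    (by linarith [le_max_right (2 * ‖s‖) (‖s‖ ^ 3)])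

lemma multipliable_barnesFactor (s : ℂ) : Multipliable (barnesFactor s) := by
  have := multipliable_one_add_of_summable (summable_norm_barnesFactor_sub_one s)
  simpa using this

lemma add_natCast_add_one_ne_zero {s : ℂ} (hs : -1 < s.re) (k : ℕ) : s + (k + 1) ≠ 0 := by
  intro h
  have := congrArg re h
  simp at this
  have hk : (0 : ℝ) ≤ k := k.cast_nonneg
  linarith

lemma tprod_barnesFactor_ne_zero {s : ℂ} (hs : -1 < s.re) : ∏' k, barnesFactor s k ≠ 0 := by
  have := tprod_one_add_ne_zero_of_summable (f := fun k => barnesFactor s k - 1) (fun k => ?_)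
    (summable_norm_barnesFactor_sub_one s)
  · simpa using this
  · have hne : (k : ℂ) + 1 ≠ 0 := by exact_mod_cast k.succ_ne_zero
    have h : 1 + s / ((k : ℂ) + 1) ≠ 0 := by
      rw [one_add_div hne]
      refine div_ne_zero ?_ hne
      rw [add_comm]; exact add_natCast_add_one_ne_zero hs k
    rw [add_sub_cancel, barnesFactor]
    exact mul_ne_zero (pow_ne_zero _ h) (exp_ne_zero _)

lemma barnesGAddOne_eq (s : ℂ) : barnesGAddOne s =
    ((2 * Real.pi : ℝ) : ℂ) ^ (s / 2)
      * exp (-(s + (1 + (Real.eulerMascheroniConstant : ℂ)) * s ^ 2) / 2)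
      * ∏' k : ℕ, barnesFactor s k := rfl

lemma barnesGAddOne_ne_zero {s : ℂ} (hs : -1 < s.re) : barnesGAddOne s ≠ 0 := by
  rw [barnesGAddOne_eq]
  refine mul_ne_zero (mul_ne_zero ?_ (exp_ne_zero _)) (tprod_barnesFactor_ne_zero hs)
  rw [cpow_def_of_ne_zero]
  · exact exp_ne_zero _
  · exact_mod_cast (by positivity : (2 * Real.pi : ℝ) ≠ 0)

lemma barnesGAddOne_zero : barnesGAddOne 0 = 1 := by
  simp [barnesGAddOne]

lemma barnesFactor_add_one (s : ℂ) (n : ℕ) (h : s + (n + 1) ≠ 0) :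
    barnesFactor (s + 1) n = barnesFactor s n * ((s + (n + 2)) / (s + (n + 1))) ^ (n + 1)
      * exp ((s + 1 / 2) / (n + 1) - 1) := by
  have hne : (n : ℂ) + 1 ≠ 0 := by exact_mod_cast n.succ_ne_zero
  have e1 : 1 + (s + 1) / ((n : ℂ) + 1)
      = (1 + s / ((n : ℂ) + 1)) * ((s + (n + 2)) / (s + (n + 1))) := by
    field_simp; ring
  have e2 : (s + 1) ^ 2 / (2 * ((n : ℂ) + 1)) - (s + 1)
      = (s ^ 2 / (2 * ((n : ℂ) + 1)) - s) + ((s + 1 / 2) / (n + 1) - 1) := by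
    field_simp; ring
  rw [barnesFactor, barnesFactor, e1, e2, exp_add, mul_pow]
  ring

/-- The powers `((s+k+2)/(s+k+1))^{k+1}` from `barnesFactor_add_one` telescope to the quotient on
the right, and the exponents `(s+1/2)/(k+1) - 1` add up to a harmonic number. -/
lemma prod_barnesFactor_add_one {s : ℂ} (hs : -1 < s.re) (n : ℕ) :
    ∏ k ∈ Finset.range n, barnesFactor (s + 1) k
      = (∏ k ∈ Finset.range n, barnesFactor s k)
        * ((s + (n + 1)) ^ n / ∏ k ∈ Finset.range n, (s + (k + 1)))
        * exp ((s + 1 / 2) * (harmonic n : ℚ) - n) := by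
  induction n with
  | zero => simp
  | succ n ih =>
    have h1 := add_natCast_add_one_ne_zero hs n
    have h2 : ∏ k ∈ Finset.range n, (s + ((k : ℂ) + 1)) ≠ 0 :=
      Finset.prod_ne_zero_iff.2 fun k _ => add_natCast_add_one_ne_zero hs k
    have e : (s + 1 / 2) * ((harmonic (n + 1) : ℚ) : ℂ) - ((n + 1 : ℕ) : ℂ)
        = ((s + 1 / 2) * (harmonic n : ℚ) - n) + ((s + 1 / 2) / (n + 1) - 1) := by
      rw [harmonic_succ]; push_cast; ring
    rw [Finset.prod_range_succ, Finset.prod_range_succ, Finset.prod_range_succ, ih, e, exp_add,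
      barnesFactor_add_one s n h1, div_pow]
    push_cast
    rw [show (s + ((n : ℂ) + 1 + 1)) = s + (n + 2) by ring]
    field_simp
    ring

lemma tendsto_stirling_inv :
    Tendsto (fun n : ℕ => (n : ℝ) ^ n * Real.exp (-n) * √n / n.factorial) atTop
      (𝓝 (√(2 * Real.pi))⁻¹) := by
  have h : Tendsto (fun n => (√2 * Stirling.stirlingSeq n)⁻¹) atTop (𝓝 (√2 * √Real.pi)⁻¹) :=
    (Stirling.tendsto_stirlingSeq_sqrt_pi.const_mul _).inv₀ (by positivity)
  rw [Real.sqrt_mul (by norm_num)]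
  refine h.congr' ?_
  filter_upwards [eventually_gt_atTop 0] with n hn
  have hn' : (0 : ℝ) < n := by exact_mod_cast hn
  have h2 : √(2 * (n : ℝ)) = √2 * √n := Real.sqrt_mul (by norm_num) _
  have h3 : √2 * √2 = (2 : ℝ) := Real.mul_self_sqrt (by norm_num)
  have h4 : √(n : ℝ) ≠ 0 := by positivity
  have h5 : Real.exp (-n) = (Real.exp 1 ^ n)⁻¹ := by
    rw [Real.exp_neg, ← Real.exp_nat_mul, mul_one]
  rw [Stirling.stirlingSeq, h2, h5, div_pow]
  field_simp

/-- The sequence is a product of five convergent ones: Euler's `GammaSeq (s+1)`, the correction for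
its extra last factor, `(1+(s+1)/n)^n`, the exponential of `H_n - log n` (source of `γ`), and
Stirling's quotient (source of `√(2π)`). -/
lemma tendsto_barnesFactor_ratio {s : ℂ} (hs : -1 < s.re) :
    Tendsto (fun n : ℕ => ((s + (n + 1)) ^ n / ∏ k ∈ Finset.range n, (s + (k + 1)))
        * exp ((s + 1 / 2) * (harmonic n : ℚ) - n)) atTop
      (𝓝 (Gamma (s + 1) * exp (s + 1) * exp ((s + 1 / 2) * Real.eulerMascheroniConstant)
        * ((√(2 * Real.pi))⁻¹ : ℝ))) := by
  have hG := GammaSeq_tendsto_Gamma (s + 1)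
  have h1 : Tendsto (fun n : ℕ => 1 + (s + 1) / (n : ℂ)) atTop (𝓝 1) := by
    have := (tendsto_const_div_atTop_nhds_zero_nat (𝕜 := ℂ) (s + 1)).const_add 1
    simpa using this
  have h2 := tendsto_one_add_div_pow_exp (s + 1)
  have h3 : Tendsto (fun n : ℕ => exp ((s + 1 / 2) * ((harmonic n - Real.log n : ℝ) : ℂ))) atTop
      (𝓝 (exp ((s + 1 / 2) * Real.eulerMascheroniConstant))) := by
    refine (continuous_exp.tendsto _).comp (Tendsto.const_mul _ ?_)
    exact (continuous_ofReal.tendsto _).comp Real.tendsto_harmonic_sub_log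
  have h4 : Tendsto (fun n : ℕ =>
      (((n : ℝ) ^ n * Real.exp (-n) * √n / n.factorial : ℝ) : ℂ)) atTop
      (𝓝 ((√(2 * Real.pi))⁻¹ : ℝ)) := (continuous_ofReal.tendsto _).comp tendsto_stirling_inv
  have hall := (((hG.mul h1).mul h2).mul h3).mul h4
  rw [mul_one] at hall
  refine hall.congr' ?_
  filter_upwards [eventually_gt_atTop 0] with n hn
  have hn' : (0 : ℝ) < n := by exact_mod_cast hn
  have hnc : (n : ℂ) ≠ 0 := by exact_mod_cast hn.ne'
  have hprod : ∏ k ∈ Finset.range n, (s + ((k : ℂ) + 1)) ≠ 0 :=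
    Finset.prod_ne_zero_iff.2 fun k _ => add_natCast_add_one_ne_zero hs k
  have hlast := add_natCast_add_one_ne_zero hs n
  have hfac : (n.factorial : ℂ) ≠ 0 := by exact_mod_cast n.factorial_ne_zero
  have eP : ∏ j ∈ Finset.range (n + 1), (s + 1 + (j : ℂ))
      = (∏ k ∈ Finset.range n, (s + ((k : ℂ) + 1))) * (s + (n + 1)) := by
    rw [Finset.prod_range_succ]
    congr 1
    · exact Finset.prod_congr rfl fun _ _ => by ring
    · ring
  have ecpow : (n : ℂ) ^ (s + 1) = exp (s * (Real.log n : ℂ)) * n := by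
    rw [cpow_add _ _ hnc, cpow_one, cpow_def_of_ne_zero hnc, ← natCast_log, mul_comm s]
  have esq : ((√(n : ℝ) : ℝ) : ℂ) = exp (1 / 2 * (Real.log n : ℂ)) := by
    rw [Real.sqrt_eq_rpow, Real.rpow_def_of_pos hn', ofReal_exp, ofReal_mul, mul_comm,
      show ((1 / 2 : ℝ) : ℂ) = 1 / 2 by norm_num]
  have e1 : 1 + (s + 1) / (n : ℂ) = (s + (n + 1)) / n := by field_simp; ring
  have e3 : exp ((s + 1 / 2) * ((harmonic n - Real.log n : ℝ) : ℂ))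
      * (exp (s * (Real.log n : ℂ)) * exp (-(n : ℂ)) * exp (1 / 2 * (Real.log n : ℂ)))
      = exp ((s + 1 / 2) * (harmonic n : ℚ) - n) := by
    rw [← exp_add, ← exp_add, ← exp_add]
    congr 1
    push_cast; ring
  rw [GammaSeq, eP, ecpow, e1, ← e3]
  push_cast
  rw [esq, div_pow, natCast_log]
  field_simp

/-- The functional equation `G(s + 2) = Γ(s + 1) G(s + 1)`. -/
lemma barnesGAddOne_add_one {s : ℂ} (hs : -1 < s.re) :
    barnesGAddOne (s + 1) = Gamma (s + 1) * barnesGAddOne s := by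
  have hlim : ∏' k, barnesFactor (s + 1) k = (∏' k, barnesFactor s k)
      * (Gamma (s + 1) * exp (s + 1) * exp ((s + 1 / 2) * Real.eulerMascheroniConstant)
        * ((√(2 * Real.pi))⁻¹ : ℝ)) := by
    refine tendsto_nhds_unique (multipliable_barnesFactor (s + 1)).tendsto_prod_tprod_nat ?_
    refine ((multipliable_barnesFactor s).tendsto_prod_tprod_nat.mul
      (tendsto_barnesFactor_ratio hs)).congr fun n => ?_
    rw [prod_barnesFactor_add_one hs, mul_assoc]
  have h2pi : ((2 * Real.pi : ℝ) : ℂ) ≠ 0 := by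
    exact_mod_cast (by positivity : (2 * Real.pi : ℝ) ≠ 0)
  have hsq : ((2 * Real.pi : ℝ) : ℂ) ^ (1 / 2 : ℂ) = ((√(2 * Real.pi) : ℝ) : ℂ) := by
    rw [Real.sqrt_eq_rpow, ofReal_cpow (by positivity)]; norm_num
  have hsq0 : ((√(2 * Real.pi) : ℝ) : ℂ) ≠ 0 := by
    exact_mod_cast (by positivity : (√(2 * Real.pi) : ℝ) ≠ 0)
  -- The quadratic exponent in the definition of `G` is exactly what absorbs the `e^{s+1}` and the
  -- `γ` produced by the limit.
  have hexp : exp (-(s + 1 + (1 + (Real.eulerMascheroniConstant : ℂ)) * (s + 1) ^ 2) / 2)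
      * exp (s + 1) * exp ((s + 1 / 2) * Real.eulerMascheroniConstant)
      = exp (-(s + (1 + (Real.eulerMascheroniConstant : ℂ)) * s ^ 2) / 2) := by
    rw [← exp_add, ← exp_add]
    congr 1; ring
  rw [barnesGAddOne_eq, barnesGAddOne_eq, hlim, add_div, cpow_add _ _ h2pi, hsq, ← hexp, ofReal_inv]
  field_simp

lemma barnesG_ne_zero {z : ℂ} (hz : 0 < z.re) : barnesG z ≠ 0 :=
  barnesGAddOne_ne_zero (by simpa using hz)

lemma barnesG_one : barnesG 1 = 1 := by simp [barnesG, barnesGAddOne_zero]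

lemma barnesG_add_one {z : ℂ} (hz : 0 < z.re) : barnesG (z + 1) = Gamma z * barnesG z := by
  have := barnesGAddOne_add_one (s := z - 1) (by simpa using hz)
  simpa [barnesG] using this

/-! ### The weight on the circle, its integrability, and the contour integrals as moments. -/

open MeasureTheory Set

/-- The weight `|1 - z|^{2α} e^{-β(θ - π)}` at `z = e^{iθ}`, `0 < θ < 2π`. -/
noncomputable def circleWeight (α β θ : ℝ) : ℝ :=
  (2 * Real.sin (θ / 2)) ^ (2 * α) * Real.exp (-β * (θ - Real.pi))

/-- The trigonometric moment `∫ z^{-m} |1 - z|^{2α} e^{-β(θ - π)} dθ`. -/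
noncomputable def circleMoment (α β : ℝ) (m : ℤ) : ℂ :=
  ∫ θ in (0 : ℝ)..2 * Real.pi, exp (θ * I) ^ (-m) * (circleWeight α β θ : ℂ)

lemma sin_half_pos {θ : ℝ} (h : θ ∈ Ioo 0 (2 * Real.pi)) : 0 < 2 * Real.sin (θ / 2) :=
  mul_pos two_pos (Real.sin_pos_of_pos_of_lt_pi (by linarith [h.1]) (by linarith [h.2]))

lemma sin_half_nonneg {θ : ℝ} (h : θ ∈ Icc 0 (2 * Real.pi)) : 0 ≤ 2 * Real.sin (θ / 2) :=
  mul_nonneg two_pos.le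
    (Real.sin_nonneg_of_nonneg_of_le_pi (by linarith [h.1]) (by linarith [h.2]))

lemma circleWeight_pos (α β : ℝ) {θ : ℝ} (h : θ ∈ Ioo 0 (2 * Real.pi)) :
    0 < circleWeight α β θ :=
  mul_pos (Real.rpow_pos_of_pos (sin_half_pos h) _) (Real.exp_pos _)

/-- Jordan's inequality `sin(t/2) ≥ t/π` on `[0, π]` controls the singularity at `0`; the reflection
`θ ↦ 2π - θ` handles the one at `2π`. -/
lemma rpow_two_sin_half_le {α θ : ℝ} (hα : α ≤ 0) (h : θ ∈ Ioo 0 (2 * Real.pi)) :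
    (2 * Real.sin (θ / 2)) ^ (2 * α)
      ≤ (2 / Real.pi) ^ (2 * α) * (θ ^ (2 * α) + (2 * Real.pi - θ) ^ (2 * α)) := by
  have hpi := Real.pi_pos
  have key : ∀ t : ℝ, 0 < t → t ≤ Real.pi → (2 * Real.sin (t / 2)) ^ (2 * α)
      ≤ (2 / Real.pi) ^ (2 * α) * t ^ (2 * α) := fun t ht ht' => by
    have h1 : 2 / Real.pi * t ≤ 2 * Real.sin (t / 2) := by
      have := Real.mul_le_sin (x := t / 2) (by linarith) (by linarith)
      linarith
    rw [← Real.mul_rpow (by positivity) ht.le]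
    exact Real.rpow_le_rpow_of_nonpos (by positivity) h1 (by linarith)
  have h0 : 0 ≤ (2 / Real.pi : ℝ) ^ (2 * α) := by positivity
  have h1 : 0 ≤ θ ^ (2 * α) := Real.rpow_nonneg h.1.le _
  have h2 : 0 ≤ (2 * Real.pi - θ) ^ (2 * α) := Real.rpow_nonneg (by linarith [h.2]) _
  rw [mul_add]
  rcases le_total θ Real.pi with hc | hc
  · have := key θ h.1 hc
    have := mul_nonneg h0 h2
    linarith
  · have h3 := key (2 * Real.pi - θ) (by linarith [h.2]) (by linarith)
    rw [show (2 * Real.pi - θ) / 2 = Real.pi - θ / 2 by ring, Real.sin_pi_sub] at h3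
    have := mul_nonneg h0 h1
    linarith

lemma intervalIntegrable_rpow_two_sin_half {α : ℝ} (hα : -1 / 2 < α) :
    IntervalIntegrable (fun θ => (2 * Real.sin (θ / 2)) ^ (2 * α)) volume 0 (2 * Real.pi) := by
  have hpi := Real.pi_pos
  rcases le_total 0 α with h | h
  · refine Continuous.intervalIntegrable ?_ _ _
    exact Continuous.rpow_const (by fun_prop) fun _ => Or.inr (by linarith)
  · have h1 : IntervalIntegrable (fun θ : ℝ => θ ^ (2 * α)) volume 0 (2 * Real.pi) :=
      intervalIntegral.intervalIntegrable_rpow' (by linarith)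
    have h2 : IntervalIntegrable (fun θ : ℝ => (2 * Real.pi - θ) ^ (2 * α)) volume 0
        (2 * Real.pi) := by
      have := (h1.comp_sub_left (2 * Real.pi)).symm
      simpa using this
    refine ((h1.add h2).const_mul ((2 / Real.pi) ^ (2 * α))).mono_fun' ?_ ?_
    · exact (Measurable.pow_const (by fun_prop) _).aestronglyMeasurable
    · rw [uIoc_of_le (by linarith)]
      rw [← restrict_Ioo_eq_restrict_Ioc]
      filter_upwards [ae_restrict_mem measurableSet_Ioo] with θ hθ
      rw [Real.norm_of_nonneg (Real.rpow_nonneg (sin_half_pos hθ).le _)]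
      exact rpow_two_sin_half_le h hθ

lemma intervalIntegrable_circleWeight {α : ℝ} (hα : -1 / 2 < α) (β : ℝ) :
    IntervalIntegrable (circleWeight α β) volume 0 (2 * Real.pi) :=
  (intervalIntegrable_rpow_two_sin_half hα).mul_continuousOn (by fun_prop)

lemma continuous_exp_mul_I_zpow (m : ℤ) : Continuous fun θ : ℝ => exp (θ * I) ^ m :=
  Continuous.zpow₀ (by fun_prop) _ fun _ => Or.inl (exp_ne_zero _)

lemma intervalIntegrable_exp_mul_circleWeight {α : ℝ} (hα : -1 / 2 < α) (β : ℝ) (m : ℤ) :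
    IntervalIntegrable (fun θ => exp (θ * I) ^ m * (circleWeight α β θ : ℂ)) volume 0
      (2 * Real.pi) := by
  have h : IntervalIntegrable (fun θ => (circleWeight α β θ : ℂ)) volume 0 (2 * Real.pi) := by
    have := (intervalIntegrable_circleWeight hα β)
    rw [intervalIntegrable_iff] at this ⊢
    exact this.ofReal
  exact h.continuousOn_mul (continuous_exp_mul_I_zpow m).continuousOn

lemma one_sub_exp_mul_I (θ : ℝ) :
    1 - exp (θ * I) = ((2 * Real.sin (θ / 2) : ℝ) : ℂ) * exp (((θ - Real.pi) / 2 : ℝ) * I) := by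
  have h1 : exp (((θ - Real.pi) / 2 : ℝ) * I) = -I * exp ((θ / 2 : ℝ) * I) := by
    rw [show (((θ - Real.pi) / 2 : ℝ) : ℂ) * I = (θ / 2 : ℝ) * I - Real.pi / 2 * I by
      push_cast; ring, exp_sub, exp_pi_div_two_mul_I, div_I]
    ring
  have h2 : exp ((θ : ℂ) * I) = exp ((θ / 2 : ℝ) * I) ^ 2 := by
    rw [← exp_nat_mul]; push_cast; ring_nf
  have h3 : exp (-((θ / 2 : ℝ) : ℂ) * I) = (exp ((θ / 2 : ℝ) * I))⁻¹ := by
    rw [neg_mul, exp_neg]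
  have hne := exp_ne_zero (((θ / 2 : ℝ) : ℂ) * I)
  rw [h1, h2, ofReal_mul, ofReal_sin, Complex.sin, h3]
  push_cast at hne ⊢
  field_simp
  ring_nf
  rw [I_sq]; ring

/-- The bases are `r e^{iφ}` and `r e^{-iφ}` with `φ = (θ-π)/2` in `(-π/2, π/2)`, so the principal
logarithms are `log r ± iφ`. The moduli give `r^{2α}`, and the arguments give `e^{iφ·2iβ} =
e^{-β(θ-π)}`. -/
lemma fisherHartwigSymbol_exp (C : ℂ) (α β : ℝ) {θ : ℝ} (h : θ ∈ Ioo 0 (2 * Real.pi)) :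
    fisherHartwigSymbol C α β (exp (θ * I)) = C * (circleWeight α β θ : ℂ) := by
  have hr := sin_half_pos h
  set r : ℝ := 2 * Real.sin (θ / 2) with hrdef
  set φ : ℝ := (θ - Real.pi) / 2 with hφ
  have hpi := Real.pi_pos
  have hφ1 : φ < Real.pi := by rw [hφ]; linarith [h.2]
  have hφ2 : -Real.pi < φ := by rw [hφ]; linarith [h.1]
  have hrc : (r : ℂ) ≠ 0 := by exact_mod_cast hr.ne'
  have hlog : ∀ ψ : ℝ, -Real.pi < ψ → ψ < Real.pi →
      log ((r : ℂ) * exp (ψ * I)) = (Real.log r : ℂ) + ψ * I := fun ψ h1 h2 => by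
    have hexp : ((r : ℂ) * exp (ψ * I)) = exp ((Real.log r : ℂ) + ψ * I) := by
      rw [exp_add, ← ofReal_exp, Real.exp_log hr]
    rw [hexp, log_exp] <;> simp <;> linarith
  have e1 : 1 - exp (θ * I) = (r : ℂ) * exp (φ * I) := one_sub_exp_mul_I θ
  have e2 : 1 - 1 / exp (θ * I) = (r : ℂ) * exp ((-φ : ℝ) * I) := by
    have := congrArg (starRingEnd ℂ) e1
    rw [map_sub, map_mul, map_one, ← exp_conj, ← exp_conj, map_mul, map_mul, conj_I, conj_ofReal,
      conj_ofReal, conj_ofReal] at this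
    rw [one_div, ← exp_neg]
    push_cast
    rw [neg_mul, ← mul_neg, ← mul_neg]; exact this
  have n1 : (r : ℂ) * exp (φ * I) ≠ 0 := mul_ne_zero hrc (exp_ne_zero _)
  have n2 : (r : ℂ) * exp ((-φ : ℝ) * I) ≠ 0 := mul_ne_zero hrc (exp_ne_zero _)
  rw [fisherHartwigSymbol, e1, e2, cpow_def_of_ne_zero n1, cpow_def_of_ne_zero n2,
    hlog φ hφ2 hφ1, hlog (-φ) (by linarith) (by linarith), mul_assoc, ← exp_add, circleWeight,
    ← hrdef, Real.rpow_def_of_pos hr, ← Real.exp_add, ofReal_exp]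
  congr 2
  rw [show θ - Real.pi = 2 * φ by rw [hφ]; ring]
  push_cast
  ring_nf
  rw [I_sq]; ring

lemma circleIntegral_eq_moment_integral (C : ℂ) (α β : ℝ) (f : ℂ → ℂ) (g : ℝ → ℂ)
    (hfg : ∀ θ : ℝ, f (exp (θ * I)) * (exp (θ * I) * I) = g θ) :
    (∮ z in C(0, 1), f z * fisherHartwigSymbol C α β z)
      = C * ∫ θ in (0 : ℝ)..2 * Real.pi, g θ * (circleWeight α β θ : ℂ) := by
  rw [circleIntegral, ← intervalIntegral.integral_const_mul]
  refine intervalIntegral.integral_congr_Ioo_of_le (by positivity) fun θ hθ => ?_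
  simp only [deriv_circleMap, circleMap, ofReal_one, one_mul, zero_add, smul_eq_mul]
  rw [fisherHartwigSymbol_exp C α β hθ, ← hfg]
  ring

lemma symbolCoeff_fisherHartwigSymbol (C : ℂ) (α β : ℝ) (m : ℤ) :
    symbolCoeff (fisherHartwigSymbol C α β) m = C * circleMoment α β m / (2 * Real.pi) := by
  have h : (∮ z in C(0, 1), fisherHartwigSymbol C α β z / z ^ (m + 1))
      = ∮ z in C(0, 1), (z ^ (m + 1))⁻¹ * fisherHartwigSymbol C α β z := by
    congr 1; ext z; rw [div_eq_inv_mul]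
  have hpi : (Real.pi : ℂ) ≠ 0 := by exact_mod_cast Real.pi_ne_zero
  rw [symbolCoeff, h, circleIntegral_eq_moment_integral C α β _
    (fun θ => I * exp (θ * I) ^ (-m)), circleMoment]
  · simp_rw [mul_assoc I]
    rw [intervalIntegral.integral_const_mul]
    field_simp
  · intro θ
    have hne := exp_ne_zero ((θ : ℂ) * I)
    rw [zpow_neg, zpow_add_one₀ hne]
    have := zpow_ne_zero m hne
    field_simp

/-! ### Recurrences for the moments, in the index and in `α`. -/

lemma add_natCast_ne_zero_of_re_pos {s : ℂ} (hs : 0 < s.re) (k : ℕ) : s + k ≠ 0 := by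
  intro h
  have := congrArg re h
  simp at this
  have hk : (0 : ℝ) ≤ k := k.cast_nonneg
  linarith

/-- The differentiated function is `(1-z) z^{-m}` times the weight, with `1 - z` in the polar form
of `one_sub_exp_mul_I`. -/
lemma hasDerivAt_circleMoment_primitive (α β : ℝ) (m : ℤ) {θ : ℝ}
    (h : θ ∈ Ioo 0 (2 * Real.pi)) :
    HasDerivAt (fun t : ℝ => (((2 * Real.sin (t / 2)) ^ (2 * α + 1)
        * Real.exp (-β * (t - Real.pi)) : ℝ) : ℂ)
        * exp (((t - Real.pi) / 2 : ℝ) * I) * exp (-m * (t * I)))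
      (-I * ((m + (α - I * β)) * (exp (θ * I) ^ (-m) * (circleWeight α β θ : ℂ))
        + (1 - m + (α + I * β)) * (exp (θ * I) ^ (-(m - 1)) * (circleWeight α β θ : ℂ)))) θ := by
  have hr := sin_half_pos h
  have hS : HasDerivAt (fun t : ℝ => 2 * Real.sin (t / 2)) (Real.cos (θ / 2)) θ := by
    have := ((Real.hasDerivAt_sin (θ / 2)).comp θ ((hasDerivAt_id θ).div_const 2)).const_mul 2
    convert! this using 1
    ring
  have hE : HasDerivAt (fun t : ℝ => Real.exp (-β * (t - Real.pi)))
      (Real.exp (-β * (θ - Real.pi)) * (-β)) θ := by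
    have := (((hasDerivAt_id θ).sub_const Real.pi).const_mul (-β)).exp
    simpa using this
  have hW := ((hS.rpow_const (p := 2 * α + 1) (Or.inl hr.ne')).mul hE).ofReal_comp
  have hφ : HasDerivAt (fun t : ℝ => exp (((t - Real.pi) / 2 : ℝ) * I))
      (exp (((θ - Real.pi) / 2 : ℝ) * I) * (((1 / 2 : ℝ) : ℂ) * I)) θ := by
    have h1 : HasDerivAt (fun t : ℝ => (t - Real.pi) / 2) (1 / 2) θ :=
      ((hasDerivAt_id θ).sub_const Real.pi).div_const 2
    exact (h1.ofReal_comp.mul_const I).cexp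
  have hz : HasDerivAt (fun t : ℝ => exp (-m * (t * I)))
      (exp (-m * (θ * I)) * (-m * (((1 : ℝ) : ℂ) * I))) θ :=
    (((hasDerivAt_id θ).ofReal_comp.mul_const I).const_mul _).cexp
  convert! (hW.mul hφ).mul hz using 1
  have hw : (2 * Real.sin (θ / 2)) ^ (2 * α + 1)
      = (2 * Real.sin (θ / 2)) ^ (2 * α) * (2 * Real.sin (θ / 2)) := by
    rw [Real.rpow_add hr, Real.rpow_one]
  have hzm : exp (θ * I) ^ (-m) = exp (-m * (θ * I)) := by
    rw [← exp_int_mul]; push_cast; rfl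
  have hzm' : exp (θ * I) ^ (-(m - 1)) = exp (-m * (θ * I)) * exp (θ * I) := by
    rw [neg_sub, sub_eq_add_neg, add_comm, zpow_add₀ (exp_ne_zero _), zpow_one, hzm]
  have hsin := one_sub_exp_mul_I θ
  have hcos : exp (θ * I) + 1 = 2 * I * ((Real.cos (θ / 2) : ℝ) : ℂ)
      * exp (((θ - Real.pi) / 2 : ℝ) * I) := by
    have h1 : exp (((θ - Real.pi) / 2 : ℝ) * I) = -I * exp ((θ / 2 : ℝ) * I) := by
      rw [show (((θ - Real.pi) / 2 : ℝ) : ℂ) * I = (θ / 2 : ℝ) * I - Real.pi / 2 * I by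
        push_cast; ring, exp_sub, exp_pi_div_two_mul_I, div_I]
      ring
    have h2 : exp ((θ : ℂ) * I) = exp ((θ / 2 : ℝ) * I) ^ 2 := by
      rw [← exp_nat_mul]; push_cast; ring_nf
    have h3 : exp (-((θ / 2 : ℝ) : ℂ) * I) = (exp ((θ / 2 : ℝ) * I))⁻¹ := by
      rw [neg_mul, exp_neg]
    have hne := exp_ne_zero (((θ / 2 : ℝ) : ℂ) * I)
    rw [h1, h2, ofReal_cos, Complex.cos, h3]
    push_cast at hne ⊢
    field_simp
    ring_nf
    rw [I_sq]; ring
  simp only [Pi.mul_apply, show 2 * α + 1 - 1 = 2 * α by ring, hw, hzm, hzm', circleWeight]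
  push_cast at hsin hcos ⊢
  set u := exp (((θ : ℂ) - Real.pi) / 2 * I)
  set s := Complex.sin ((θ : ℂ) / 2)
  set c := Complex.cos ((θ : ℂ) / 2)
  set z := exp ((θ : ℂ) * I)
  set Z := exp (-(m : ℂ) * (θ * I))
  set R := (((2 * Real.sin (θ / 2)) ^ (2 * α) : ℝ) : ℂ)
  set X := exp (-(β : ℂ) * ((θ : ℂ) - Real.pi))
  -- The half-angle products `c u` and `s u` are polynomials in `z`, which makes the final identity
  -- linear algebra.
  have hcu : c * u = -I / 2 * (z + 1) := by
    rw [hcos]; linear_combination (c * u) * I_sq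
  have hsu : 2 * s * u = 1 - z := hsin.symm
  linear_combination (-(R * X * Z * (2 * α + 1))) * hcu
    - (R * X * Z * (-β + I / 2 - m * I)) * hsu
    + (R * X * Z * β * (1 - z)) * I_sq

lemma circleMoment_recurrence {α : ℝ} (hα : -1 / 2 < α) (β : ℝ) (m : ℤ) :
    (m + (α - I * β)) * circleMoment α β m
      + (1 - m + (α + I * β)) * circleMoment α β (m - 1) = 0 := by
  have hint1 := intervalIntegrable_exp_mul_circleWeight hα β (-m)
  have hint2 := intervalIntegrable_exp_mul_circleWeight hα β (-(m - 1))
  have hint := ((hint1.const_mul (m + (α - I * β))).add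
    (hint2.const_mul (1 - m + (α + I * β)))).const_mul (-I)
  have hftc := intervalIntegral.integral_eq_sub_of_hasDerivAt_of_le (by positivity) ?_
    (fun θ hθ => hasDerivAt_circleMoment_primitive α β m hθ) hint
  · rw [intervalIntegral.integral_const_mul, intervalIntegral.integral_add
      (hint1.const_mul _) (hint2.const_mul _), intervalIntegral.integral_const_mul,
      intervalIntegral.integral_const_mul] at hftc
    have hne : 2 * α + 1 ≠ 0 := by linarith
    -- Both boundary terms vanish because `2α + 1 > 0`.
    have hzero : (0 : ℝ) ^ (2 * α + 1) = 0 := Real.zero_rpow hne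
    rw [show 2 * Real.pi / 2 = Real.pi by ring] at hftc
    simp only [Real.sin_pi, zero_div, Real.sin_zero, mul_zero, hzero, zero_mul, ofReal_zero,
      sub_self] at hftc
    simpa [circleMoment, I_ne_zero] using hftc
  · refine Continuous.continuousOn ?_
    have h1 : Continuous fun t : ℝ => (2 * Real.sin (t / 2)) ^ (2 * α + 1) :=
      Continuous.rpow_const (by fun_prop) fun _ => Or.inr (by linarith)
    fun_prop

lemma circleWeight_add_one (α β : ℝ) {θ : ℝ} (h : θ ∈ Ioo 0 (2 * Real.pi)) :
    (circleWeight (α + 1) β θ : ℂ)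
      = (2 - exp (θ * I) - (exp (θ * I))⁻¹) * (circleWeight α β θ : ℂ) := by
  have hr := sin_half_pos h
  have hw : (2 * Real.sin (θ / 2)) ^ (2 * (α + 1))
      = (2 * Real.sin (θ / 2)) ^ (2 * α) * (2 * Real.sin (θ / 2)) ^ 2 := by
    rw [mul_add, Real.rpow_add hr]; norm_num
  have h2 : 2 - exp (θ * I) - (exp (θ * I))⁻¹ = (((2 * Real.sin (θ / 2)) ^ 2 : ℝ) : ℂ) := by
    have hs : (2 * Real.sin (θ / 2)) ^ 2 = 2 - 2 * Real.cos θ := by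
      rw [mul_pow, Real.sin_sq_eq_half_sub, show 2 * (θ / 2) = θ by ring]; ring
    rw [hs, ← exp_neg, ← neg_mul]
    push_cast
    rw [Complex.cos]; ring
  rw [h2, circleWeight, circleWeight, hw]
  push_cast; ring

lemma circleMoment_add_one_left {α : ℝ} (hα : -1 / 2 < α) (β : ℝ) :
    circleMoment (α + 1) β 0
      = 2 * circleMoment α β 0 - circleMoment α β (-1) - circleMoment α β 1 := by
  have hint := intervalIntegrable_exp_mul_circleWeight hα β
  have e : circleMoment (α + 1) β 0 = ∫ θ in (0 : ℝ)..2 * Real.pi,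
      (2 * (exp (θ * I) ^ (-(0 : ℤ)) * (circleWeight α β θ : ℂ))
        - exp (θ * I) ^ (-(-1 : ℤ)) * (circleWeight α β θ : ℂ)
        - exp (θ * I) ^ (-(1 : ℤ)) * (circleWeight α β θ : ℂ)) := by
    refine intervalIntegral.integral_congr_Ioo_of_le (by positivity) fun θ hθ => ?_
    simp only [circleWeight_add_one α β hθ]
    simp
    ring
  rw [e, intervalIntegral.integral_sub (((hint _).const_mul 2).sub (hint _)) (hint _),
    intervalIntegral.integral_sub ((hint _).const_mul 2) (hint _),
    intervalIntegral.integral_const_mul]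
  rfl

/-- The recurrence at `m = 1` and `m = 0` eliminates the moments of index `1` and `-1`; with `s = a
+ b = 2α`, the remaining coefficient factors as `(s+1)(s+2)`. -/
lemma circleMoment_zero_add_one {α : ℝ} (hα : -1 / 2 < α) (β : ℝ) :
    (α + I * β + 1) * (α - I * β + 1) * circleMoment (α + 1) β 0
      = (2 * α + 1) * (2 * α + 2) * circleMoment α β 0 := by
  have h1 := circleMoment_recurrence hα β 1
  have h0 := circleMoment_recurrence hα β 0
  rw [circleMoment_add_one_left hα]
  norm_num at h1 h0
  linear_combination (-(α + I * β + 1)) * h1 - (α - I * β + 1) * h0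

/-! ### Gamma asymptotics and the closed form of the moments. -/

lemma Gamma_add_natCast_eq_prod {z : ℂ} (hz : 0 < z.re) (n : ℕ) :
    Gamma (z + n) = (∏ j ∈ Finset.range n, (z + j)) * Gamma z := by
  induction n with
  | zero => simp
  | succ n ih =>
    rw [Finset.prod_range_succ, Nat.cast_add_one, ← add_assoc,
      Gamma_add_one _ (add_natCast_ne_zero_of_re_pos hz n), ih]
    ring

lemma tendsto_Gamma_add_natCast_div {z : ℂ} (hz : 0 < z.re) :
    Tendsto (fun n : ℕ => Gamma (z + n) / ((n : ℂ) ^ z * Gamma n)) atTop (𝓝 1) := by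
  have hG := Gamma_ne_zero_of_re_pos hz
  have h1 : Tendsto (fun n : ℕ => (1 + z / (n : ℂ))⁻¹) atTop (𝓝 1) := by
    have := ((tendsto_const_div_atTop_nhds_zero_nat (𝕜 := ℂ) z).const_add 1).inv₀ (by simp)
    simpa using this
  have h2 : Tendsto (fun n : ℕ => Gamma z / GammaSeq z n) atTop (𝓝 1) := by
    have := (tendsto_const_nhds (x := Gamma z)).div (GammaSeq_tendsto_Gamma z) hG
    rwa [div_self hG] at this
  have := h1.mul h2
  rw [mul_one] at this
  refine this.congr' ?_
  filter_upwards [eventually_gt_atTop 0] with n hn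
  have hnc : (n : ℂ) ≠ 0 := by exact_mod_cast hn.ne'
  obtain ⟨k, rfl⟩ : ∃ k, n = k + 1 := ⟨n - 1, by omega⟩
  have hprod : ∏ j ∈ Finset.range (k + 1 + 1), (z + j)
      = Gamma (z + (k + 1 : ℕ)) * (z + (k + 1 : ℕ)) / Gamma z := by
    rw [Finset.prod_range_succ, Gamma_add_natCast_eq_prod hz]
    field_simp
  have hG' : Gamma (z + (k + 1 : ℕ)) ≠ 0 := by
    refine Gamma_ne_zero_of_re_pos ?_
    have : (0 : ℝ) ≤ k := k.cast_nonneg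
    simp; linarith
  have hz' := add_natCast_ne_zero_of_re_pos hz (k + 1)
  have hpow : ((k + 1 : ℕ) : ℂ) ^ z ≠ 0 := by
    rw [cpow_def_of_ne_zero hnc]; exact exp_ne_zero _
  have hfac : (k.factorial : ℂ) ≠ 0 := by exact_mod_cast k.factorial_ne_zero
  have hGn : Gamma ((k + 1 : ℕ) : ℂ) = k.factorial := by
    rw [← Gamma_nat_eq_factorial]; push_cast; rfl
  rw [GammaSeq, hprod, hGn, Nat.factorial_succ, one_add_div hnc, add_comm _ z]
  push_cast at *
  field_simp

lemma ofReal_two_rpow (x : ℝ) : (((2 : ℝ) ^ x : ℝ) : ℂ) = 2 ^ (x : ℂ) := by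
  rw [ofReal_cpow (by norm_num)]; norm_num

lemma tendsto_Gamma_quotient {α : ℝ} (hα : -1 / 2 < α) (β : ℝ) :
    Tendsto (fun n : ℕ => Gamma (α + I * β + 1 + n) * Gamma (α - I * β + 1 + n)
      * Gamma (1 + 2 * n) / (Gamma (2 * α + 1 + 2 * n) * Gamma (1 + n) ^ 2)) atTop
      (𝓝 (((2 : ℝ) ^ (2 * α) : ℝ) : ℂ)⁻¹) := by
  have h1 := tendsto_Gamma_add_natCast_div (z := α + I * β + 1) (by simp; linarith)
  have h2 := tendsto_Gamma_add_natCast_div (z := α - I * β + 1) (by simp; linarith)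
  have h3 := (tendsto_Gamma_add_natCast_div (z := 2 * α + 1) (by simp; linarith)).comp
    (tendsto_id.const_mul_atTop' (r := 2) two_pos)
  have hlim := ((h1.mul h2).div h3 one_ne_zero).mul_const (((2 : ℝ) ^ (2 * α) : ℝ) : ℂ)⁻¹
  rw [mul_one, div_one, one_mul] at hlim
  refine hlim.congr' ?_
  filter_upwards [eventually_gt_atTop 0] with n hn
  have hnc : (n : ℂ) ≠ 0 := by exact_mod_cast hn.ne'
  have hGn : Gamma (n : ℂ) ≠ 0 := Gamma_ne_zero_of_re_pos (by simpa using hn)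
  have hG2n : Gamma (2 * n : ℂ) ≠ 0 := Gamma_ne_zero_of_re_pos (by simpa using hn)
  have hG3 : Gamma (2 * α + 1 + 2 * n : ℂ) ≠ 0 := by
    refine Gamma_ne_zero_of_re_pos ?_
    have : (0 : ℝ) ≤ n := n.cast_nonneg
    simp; linarith
  have e1 : Gamma (1 + 2 * n : ℂ) = 2 * n * Gamma (2 * n) := by
    rw [add_comm, Gamma_add_one _ (by simpa using hnc)]
  have e2 : Gamma (1 + n : ℂ) = n * Gamma n := by rw [add_comm, Gamma_add_one _ hnc]
  have e3 : (n : ℂ) ^ (α + I * β + 1 : ℂ) * (n : ℂ) ^ (α - I * β + 1 : ℂ)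
      = (n : ℂ) ^ (2 * α : ℂ) * n ^ 2 := by
    rw [← cpow_add _ _ hnc, ← cpow_natCast, ← cpow_add _ _ hnc]
    congr 1; push_cast; ring
  have e4 : ((2 * n : ℕ) : ℂ) ^ (2 * α + 1 : ℂ)
      = 2 * 2 ^ (2 * α : ℂ) * ((n : ℂ) ^ (2 * α : ℂ) * n) := by
    rw [Nat.cast_mul, natCast_mul_natCast_cpow, cpow_add _ _ hnc,
      cpow_add _ _ (by norm_num), cpow_one, cpow_one]
    push_cast; ring
  have n1 : (n : ℂ) ^ (2 * α : ℂ) ≠ 0 := by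
    rw [cpow_def_of_ne_zero hnc]; exact exp_ne_zero _
  have n2 : (2 : ℂ) ^ (2 * α : ℂ) ≠ 0 := by
    rw [cpow_def_of_ne_zero two_ne_zero]; exact exp_ne_zero _
  simp only [Pi.div_apply, Function.comp, id]
  rw [div_mul_div_comm, mul_mul_mul_comm, e3, e4, e1, e2, ofReal_two_rpow]
  push_cast
  generalize (n : ℂ) ^ (2 * α : ℂ) = A at n1 ⊢
  field_simp

lemma circleMoment_zero_eq_ofReal (α β : ℝ) :
    circleMoment α β 0 = ((∫ θ in (0 : ℝ)..2 * Real.pi, circleWeight α β θ : ℝ) : ℂ) := by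
  rw [circleMoment, ← intervalIntegral.integral_ofReal]
  simp

lemma integral_circleWeight_pos {α : ℝ} (hα : -1 / 2 < α) (β : ℝ) :
    0 < ∫ θ in (0 : ℝ)..2 * Real.pi, circleWeight α β θ :=
  intervalIntegral.intervalIntegral_pos_of_pos_on (intervalIntegrable_circleWeight hα β)
    (fun _ h => circleWeight_pos α β h) (by positivity)

lemma circleMoment_zero_ne_zero {α : ℝ} (hα : -1 / 2 < α) (β : ℝ) :
    circleMoment α β 0 ≠ 0 := by
  rw [circleMoment_zero_eq_ofReal]
  exact_mod_cast (integral_circleWeight_pos hα β).ne'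

lemma circleWeight_add_natCast (α β : ℝ) (n : ℕ) {θ : ℝ} (h : θ ∈ Ioo 0 (2 * Real.pi)) :
    circleWeight (α + n) β θ = ((2 * Real.sin (θ / 2)) ^ 2) ^ n * circleWeight α β θ := by
  rw [circleWeight, circleWeight, mul_add, Real.rpow_add (sin_half_pos h), ← pow_mul,
    ← Real.rpow_natCast _ (2 * n)]
  push_cast; ring

/-- The normalized densities `(2 sin(θ/2))^{2n}` concentrate at their unique maximum `θ = π`, so the
ratio tends to the weight there. The factor `e^{-β(θ-π)}` equals 1 at that point, so `β` drops out.
-/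
lemma tendsto_circleMoment_ratio {α : ℝ} (hα : -1 / 2 < α) (β : ℝ) :
    Tendsto (fun n : ℕ => circleMoment (α + n) β 0 / circleMoment n 0 0) atTop
      (𝓝 (((2 : ℝ) ^ (2 * α) : ℝ) : ℂ)) := by
  have hpi := Real.pi_pos
  have key := tendsto_setIntegral_pow_smul_of_unique_maximum_of_isCompact_of_integrableOn
    (μ := (volume : Measure ℝ)) (s := Icc 0 (2 * Real.pi)) (x₀ := Real.pi)
    (c := fun θ => (2 * Real.sin (θ / 2)) ^ 2) (g := circleWeight α β) isCompact_Icc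
    (by fun_prop) ?_ ?_ ?_ ?_ ?_ ?_
  · have hg : circleWeight α β Real.pi = (2 : ℝ) ^ (2 * α) := by simp [circleWeight]
    rw [hg] at key
    refine ((continuous_ofReal.tendsto _).comp key).congr fun n => ?_
    have e1 : ∫ θ in (0 : ℝ)..2 * Real.pi, circleWeight (α + n) β θ
        = ∫ θ in Icc 0 (2 * Real.pi), ((2 * Real.sin (θ / 2)) ^ 2) ^ n • circleWeight α β θ := by
      rw [integral_Icc_eq_integral_Ioc, ← intervalIntegral.integral_of_le (by positivity)]
      refine intervalIntegral.integral_congr_Ioo_of_le (by positivity) fun θ hθ => ?_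
      simp only [circleWeight_add_natCast α β n hθ, smul_eq_mul]
    have e2 : ∫ θ in (0 : ℝ)..2 * Real.pi, circleWeight n 0 θ
        = ∫ θ in Icc 0 (2 * Real.pi), ((2 * Real.sin (θ / 2)) ^ 2) ^ n := by
      rw [integral_Icc_eq_integral_Ioc, ← intervalIntegral.integral_of_le (by positivity)]
      refine intervalIntegral.integral_congr_Ioo_of_le (by positivity) fun θ hθ => ?_
      have := circleWeight_add_natCast 0 0 n hθ
      simp only [zero_add] at this
      simp only [this]
      simp [circleWeight]
    rw [circleMoment_zero_eq_ofReal, circleMoment_zero_eq_ofReal, e1, e2]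
    simp only [Function.comp, smul_eq_mul]
    push_cast
    rw [div_eq_inv_mul]
  · intro θ hθ hne
    have h1 : Real.sin (θ / 2) < 1 := by
      rcases lt_or_gt_of_ne hne with h | h
      · rw [← Real.sin_pi_div_two]
        exact Real.sin_lt_sin_of_lt_of_le_pi_div_two (by linarith [hθ.1]) le_rfl (by linarith)
      · rw [← Real.sin_pi_div_two, ← Real.sin_pi_sub (θ / 2)]
        exact Real.sin_lt_sin_of_lt_of_le_pi_div_two (by linarith [hθ.2]) le_rfl (by linarith)
    have h0 := sin_half_nonneg hθ
    simp only [Real.sin_pi_div_two]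
    nlinarith
  · intro θ _; positivity
  · simp
  · rw [interior_Icc, closure_Ioo (by positivity)]
    constructor <;> linarith
  · exact (intervalIntegrable_iff_integrableOn_Icc_of_le (by positivity)).1
      (intervalIntegrable_circleWeight hα β)
  · refine ContinuousAt.continuousWithinAt ?_
    refine ContinuousAt.mul (ContinuousAt.rpow_const (by fun_prop) (Or.inl ?_)) (by fun_prop)
    simp

/-- The zeroth moment divided by its closed form. -/
noncomputable def normalizedMass (α β : ℝ) : ℂ :=
  circleMoment α β 0 * (Gamma (α + I * β + 1) * Gamma (α - I * β + 1)) / Gamma (2 * α + 1)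

lemma normalizedMass_add_one {α : ℝ} (hα : -1 / 2 < α) (β : ℝ) :
    normalizedMass (α + 1) β = normalizedMass α β := by
  have n1 : (α + I * β + 1 : ℂ) ≠ 0 := by
    simpa using add_natCast_ne_zero_of_re_pos (s := α + I * β + 1) (by simp; linarith) 0
  have n2 : (α - I * β + 1 : ℂ) ≠ 0 := by
    simpa using add_natCast_ne_zero_of_re_pos (s := α - I * β + 1) (by simp; linarith) 0
  have h3 : 0 < (2 * α + 1 : ℂ).re := by simp; linarith
  have n3 : (2 * α + 1 : ℂ) ≠ 0 := by
    simpa using add_natCast_ne_zero_of_re_pos h3 0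
  have n4 : (2 * α + 2 : ℂ) ≠ 0 := by
    have := add_natCast_ne_zero_of_re_pos h3 1
    intro h; apply this; rw [← h]; push_cast; ring
  have hG := Gamma_ne_zero_of_re_pos h3
  have e1 : Gamma ((α + 1 : ℝ) + I * β + 1) = (α + I * β + 1) * Gamma (α + I * β + 1) := by
    rw [← Gamma_add_one _ n1]; congr 1; push_cast; ring
  have e2 : Gamma ((α + 1 : ℝ) - I * β + 1) = (α - I * β + 1) * Gamma (α - I * β + 1) := by
    rw [← Gamma_add_one _ n2]; congr 1; push_cast; ring
  have e3 : Gamma (2 * (α + 1 : ℝ) + 1) = (2 * α + 2) * ((2 * α + 1) * Gamma (2 * α + 1)) := by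
    rw [← Gamma_add_one _ n3, show (2 * α + 1 + 1 : ℂ) = 2 * α + 2 by ring, ← Gamma_add_one _ n4]
    congr 1; push_cast; ring
  have hrec := circleMoment_zero_add_one hα β
  rw [normalizedMass, normalizedMass, e1, e2, e3, div_eq_div_iff (by positivity) hG]
  linear_combination (Gamma (α + I * β + 1) * Gamma (α - I * β + 1) * Gamma (2 * α + 1)) * hrec

lemma normalizedMass_add_natCast {α : ℝ} (hα : -1 / 2 < α) (β : ℝ) (n : ℕ) :
    normalizedMass (α + n) β = normalizedMass α β := by
  induction n with
  | zero => simp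
  | succ n ih =>
    have : (0 : ℝ) ≤ n := n.cast_nonneg
    have h := normalizedMass_add_one (α := α + n) (by linarith) β
    rw [ih] at h
    rw [← h]
    congr 1; push_cast; ring

lemma normalizedMass_zero_zero : normalizedMass 0 0 = 2 * Real.pi := by
  simp [normalizedMass, circleMoment, circleWeight]

/-- By periodicity, the product of the moment ratio and the Gamma quotient does not depend on `n`
and equals `normalizedMass α β / (2π)`; its limit is `2^{2α} · 2^{-2α} = 1`. -/
lemma normalizedMass_eq {α : ℝ} (hα : -1 / 2 < α) (β : ℝ) :
    normalizedMass α β = 2 * Real.pi := by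
  have h2 : (((2 : ℝ) ^ (2 * α) : ℝ) : ℂ) ≠ 0 := by
    exact_mod_cast (by positivity : (2 : ℝ) ^ (2 * α) ≠ 0)
  have hlim := (tendsto_circleMoment_ratio hα β).mul (tendsto_Gamma_quotient hα β)
  rw [mul_inv_cancel₀ h2] at hlim
  have hconst : ∀ n : ℕ, circleMoment (α + n) β 0 / circleMoment n 0 0
      * (Gamma (α + I * β + 1 + n) * Gamma (α - I * β + 1 + n)
      * Gamma (1 + 2 * n) / (Gamma (2 * α + 1 + 2 * n) * Gamma (1 + n) ^ 2))
      = normalizedMass α β / (2 * Real.pi) := fun n => by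
    have hn : (0 : ℝ) ≤ n := n.cast_nonneg
    have h0 := normalizedMass_add_natCast (α := 0) (by norm_num) 0 n
    rw [← normalizedMass_add_natCast hα β n, ← normalizedMass_zero_zero, ← h0, normalizedMass,
      normalizedMass, zero_add]
    have g1 : Gamma (2 * α + 1 + 2 * n : ℂ) ≠ 0 :=
      Gamma_ne_zero_of_re_pos (by simp; linarith)
    have g2 : Gamma (1 + n : ℂ) ≠ 0 := Gamma_ne_zero_of_re_pos (by simp; linarith)
    have g3 : Gamma (1 + 2 * n : ℂ) ≠ 0 := Gamma_ne_zero_of_re_pos (by simp; linarith)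
    have g4 := circleMoment_zero_ne_zero (α := n) (by linarith) 0
    rw [show (((α + n : ℝ) : ℂ) + I * β + 1) = α + I * β + 1 + n by push_cast; ring,
      show (((α + n : ℝ) : ℂ) - I * β + 1) = α - I * β + 1 + n by push_cast; ring,
      show (2 * ((α + n : ℝ) : ℂ) + 1) = 2 * α + 1 + 2 * n by push_cast; ring,
      show (((n : ℝ) : ℂ) + I * (0 : ℝ) + 1) = 1 + n by push_cast; ring,
      show (((n : ℝ) : ℂ) - I * (0 : ℝ) + 1) = 1 + n by push_cast; ring,
      show (2 * ((n : ℝ) : ℂ) + 1) = 1 + 2 * n by push_cast; ring]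
    field_simp
  rw [funext hconst] at hlim
  have := tendsto_nhds_unique tendsto_const_nhds hlim
  rw [div_eq_one_iff_eq (by simp)] at this
  exact this

/-- The closed form of the zeroth moment. -/
lemma circleMoment_zero_eq {α : ℝ} (hα : -1 / 2 < α) (β : ℝ) :
    circleMoment α β 0 = 2 * Real.pi * Gamma (2 * α + 1)
      * ((Gamma (α + I * β + 1))⁻¹ * (Gamma (α - I * β + 1))⁻¹) := by
  have h := normalizedMass_eq hα β
  have g1 : Gamma (α + I * β + 1) ≠ 0 := Gamma_ne_zero_of_re_pos (by simp; linarith)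
  have g2 : Gamma (α - I * β + 1) ≠ 0 := Gamma_ne_zero_of_re_pos (by simp; linarith)
  have g3 : Gamma (2 * α + 1) ≠ 0 := Gamma_ne_zero_of_re_pos (by simp; linarith)
  rw [normalizedMass, div_eq_iff g3] at h
  rw [← h]
  field_simp

/-- The closed form of all moments: `2π Γ(2α+1) (-1)^m / (Γ(1+α+iβ-m) Γ(1+α-iβ+m))`. -/
lemma circleMoment_eq {α : ℝ} (hα : -1 / 2 < α) (β : ℝ) (m : ℤ) :
    circleMoment α β m = 2 * Real.pi * Gamma (2 * α + 1) * (-1) ^ m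
      * ((Gamma (α + I * β + 1 - m))⁻¹ * (Gamma (α - I * β + 1 + m))⁻¹) := by
  induction m using Int.induction_on with
  | zero => simpa using circleMoment_zero_eq hα β
  | succ k ih =>
    have hrec := circleMoment_recurrence hα β (k + 1)
    have hne : (α - I * β + 1 + k : ℂ) ≠ 0 :=
      add_natCast_ne_zero_of_re_pos (by simp; linarith) k
    have e1 := one_div_Gamma_eq_self_mul_one_div_Gamma_add_one (α - I * β + 1 + k)
    -- Here the argument may be a pole of `Γ`. The reciprocal form of the functional equation holds
    -- there too, because `Gamma` takes the value 0 at its poles.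
    have e2 := one_div_Gamma_eq_self_mul_one_div_Gamma_add_one (α + I * β - k)
    rw [show (α + I * β - k + 1 : ℂ) = α + I * β + 1 - k by ring] at e2
    rw [add_sub_cancel_right, ih] at hrec
    push_cast at hrec ⊢
    rw [e1] at hrec
    rw [show (α + I * β + 1 - (k + 1) : ℂ) = α + I * β - k by ring, e2,
      show (α - I * β + 1 + (k + 1) : ℂ) = α - I * β + 1 + k + 1 by ring]
    rw [zpow_add_one₀ (by norm_num)]
    refine mul_left_cancel₀ hne ?_
    linear_combination hrec
  | pred k ih =>
    have hrec := circleMoment_recurrence hα β (-k)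
    have hne : (α + I * β + 1 + k : ℂ) ≠ 0 :=
      add_natCast_ne_zero_of_re_pos (by simp; linarith) k
    have e1 := one_div_Gamma_eq_self_mul_one_div_Gamma_add_one (α + I * β + 1 + k)
    have e2 := one_div_Gamma_eq_self_mul_one_div_Gamma_add_one (α - I * β - k)
    rw [ih] at hrec
    push_cast at hrec ⊢
    rw [show (α + I * β + 1 - -(k : ℂ)) = α + I * β + 1 + k by ring, e1,
      show (α - I * β + 1 + -(k : ℂ)) = α - I * β - k + 1 by ring] at hrec
    rw [show (α + I * β + 1 - (-(k : ℂ) - 1)) = α + I * β + 1 + k + 1 by ring,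
      show (α - I * β + 1 + (-(k : ℂ) - 1)) = α - I * β - k by ring, e2]
    rw [zpow_sub_one₀ (by norm_num)]
    refine mul_left_cancel₀ hne ?_
    linear_combination hrec

/-! ### Explicit orthogonal polynomials from the Szegő recurrence. -/

lemma intervalIntegrable_mul_circleWeight {α : ℝ} (hα : -1 / 2 < α) (β : ℝ)
    {f : ℝ → ℂ} (hf : Continuous f) :
    IntervalIntegrable (fun θ => f θ * (circleWeight α β θ : ℂ)) volume 0 (2 * Real.pi) := by
  have := (intervalIntegrable_exp_mul_circleWeight hα β 0).continuousOn_mul hf.continuousOn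
  simpa using this

lemma continuous_eval_exp_mul_I (p : Polynomial ℂ) :
    Continuous fun θ : ℝ => p.eval (exp (θ * I)) :=
  p.continuous.comp (by fun_prop)

/-- The pairing `∫ p(z) z^{-k} |1 - z|^{2α} e^{-β(θ - π)} dθ` of a polynomial with `z^k`. -/
noncomputable def monomialPairing (α β : ℝ) (p : Polynomial ℂ) (k : ℤ) : ℂ :=
  ∫ θ in (0 : ℝ)..2 * Real.pi,
    p.eval (exp (θ * I)) * exp (θ * I) ^ (-k) * (circleWeight α β θ : ℂ)

lemma monomialPairing_one (α β : ℝ) (k : ℤ) :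
    monomialPairing α β 1 k = circleMoment α β k := by
  simp [monomialPairing, circleMoment]

lemma monomialPairing_X_mul (α β : ℝ) (p : Polynomial ℂ) (k : ℤ) :
    monomialPairing α β (Polynomial.X * p) k = monomialPairing α β p (k - 1) := by
  rw [monomialPairing, monomialPairing]
  congr 1
  ext θ
  rw [neg_sub, sub_eq_add_neg, zpow_add₀ (exp_ne_zero _), zpow_one,
    Polynomial.eval_mul, Polynomial.eval_X]
  ring

lemma monomialPairing_add_C_mul {α : ℝ} (hα : -1 / 2 < α) (β : ℝ) (p q : Polynomial ℂ) (c : ℂ)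
    (k : ℤ) : monomialPairing α β (p + Polynomial.C c * q) k
      = monomialPairing α β p k + c * monomialPairing α β q k := by
  have hint : ∀ p : Polynomial ℂ, IntervalIntegrable (fun θ : ℝ =>
      p.eval (exp (θ * I)) * exp (θ * I) ^ (-k) * (circleWeight α β θ : ℂ)) volume 0
      (2 * Real.pi) := fun p => intervalIntegrable_mul_circleWeight hα β
        ((continuous_eval_exp_mul_I p).mul (continuous_exp_mul_I_zpow _))
  simp only [monomialPairing]
  rw [← intervalIntegral.integral_const_mul,
    ← intervalIntegral.integral_add (hint p) ((hint q).const_mul c)]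
  congr 1
  ext θ
  simp
  ring

/-- The Verblunsky-type coefficient `(b)_{n+1} / (a+1)_{n+1}`. -/
noncomputable def reflectionCoeff (a b : ℂ) (n : ℕ) : ℂ :=
  b * (Gamma (b + 1 + n) / Gamma (b + 1)) * (Gamma (a + 1) / Gamma (a + 1 + n + 1))

/-- The monic orthogonal polynomial of degree `n` and its reversal, by the Szegő recurrence. -/
noncomputable def szegoPair (a b : ℂ) : ℕ → Polynomial ℂ × Polynomial ℂ
  | 0 => (1, 1)
  | n + 1 =>
    (Polynomial.X * (szegoPair a b n).1
        + Polynomial.C (reflectionCoeff a b n) * (szegoPair a b n).2,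
      (szegoPair a b n).2
        + Polynomial.C (reflectionCoeff b a n) * (Polynomial.X * (szegoPair a b n).1))

lemma szegoPair_degree (a b : ℂ) (n : ℕ) :
    ((szegoPair a b n).1.Monic ∧ (szegoPair a b n).1.natDegree = n)
      ∧ (szegoPair a b n).2.natDegree ≤ n := by
  induction n with
  | zero => simp [szegoPair]
  | succ n ih =>
    obtain ⟨⟨hm, hd⟩, hd'⟩ := ih
    have hX : (Polynomial.X * (szegoPair a b n).1).Monic := Polynomial.monic_X.mul hm
    have hXd : (Polynomial.X * (szegoPair a b n).1).natDegree = n + 1 := by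
      rw [Polynomial.natDegree_X_mul hm.ne_zero, hd]
    have hCd : (Polynomial.C (reflectionCoeff a b n) * (szegoPair a b n).2).natDegree
        < (Polynomial.X * (szegoPair a b n).1).natDegree := by
      rw [hXd]
      exact Nat.lt_succ_of_le ((Polynomial.natDegree_C_mul_le _ _).trans hd')
    refine ⟨⟨?_, ?_⟩, ?_⟩
    · exact hX.add_of_left (Polynomial.degree_lt_degree hCd)
    · rw [szegoPair, Polynomial.natDegree_add_eq_left_of_natDegree_lt hCd, hXd]
    · refine Polynomial.natDegree_add_le_of_degree_le (hd'.trans n.le_succ) ?_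
      exact (Polynomial.natDegree_C_mul_le _ _).trans hXd.le

/-- Multiplication by `X` shifts `k` to `k - 1`, hence the claim for all integers `k`. The shift
turns `∏ (i - k)` into `∏ (i + 1 - k)`, the product belonging to the reversed polynomial. After
extracting common factors, each half of the induction step is a rational identity leaving one new
linear factor: `-k` in the first, `n + 1 - k` in the second. -/
lemma monomialPairing_szegoPair {α : ℝ} (hα : -1 / 2 < α) (β : ℝ) (n : ℕ) :
    ∀ k : ℤ,
    monomialPairing α β (szegoPair (α + I * β) (α - I * β) n).1 k
      = 2 * Real.pi * Gamma (2 * α + 1 + n)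
        * (Gamma (α + I * β + 1) / Gamma (α + I * β + 1 + n))
        * (∏ i ∈ Finset.range n, ((i : ℂ) - k)) * (-1) ^ k
        * ((Gamma (α + I * β + 1 + n - k))⁻¹ * (Gamma (α - I * β + 1 + k))⁻¹) ∧
    monomialPairing α β (szegoPair (α + I * β) (α - I * β) n).2 k
      = 2 * Real.pi * Gamma (2 * α + 1 + n)
        * (Gamma (α - I * β + 1) / Gamma (α - I * β + 1 + n))
        * (∏ i ∈ Finset.range n, ((i : ℂ) + 1 - k)) * (-1) ^ k
        * ((Gamma (α + I * β + 1 + n - k))⁻¹ * (Gamma (α - I * β + 1 + k))⁻¹) := by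
  have ha : 0 < (α + I * β + 1 : ℂ).re := by simp; linarith
  have hb : 0 < (α - I * β + 1 : ℂ).re := by simp; linarith
  have hc : 0 < (2 * α + 1 : ℂ).re := by simp; linarith
  have hGa := Gamma_ne_zero_of_re_pos ha
  have hGb := Gamma_ne_zero_of_re_pos hb
  induction n with
  | zero =>
    intro k
    simp only [szegoPair, monomialPairing_one, circleMoment_eq hα]
    simp [div_self hGa, div_self hGb]
  | succ n ih =>
    intro k
    have hna := add_natCast_ne_zero_of_re_pos ha n
    have hnb := add_natCast_ne_zero_of_re_pos hb n
    have hnc := add_natCast_ne_zero_of_re_pos hc n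
    have hGan : Gamma (α + I * β + 1 + n) ≠ 0 :=
      Gamma_ne_zero_of_re_pos (by rw [add_re]; simp at ha ⊢; positivity)
    have hGbn : Gamma (α - I * β + 1 + n) ≠ 0 :=
      Gamma_ne_zero_of_re_pos (by rw [add_re]; simp at hb ⊢; positivity)
    have ea : Gamma (α + I * β + 1 + n + 1) = (α + I * β + 1 + n) * Gamma (α + I * β + 1 + n) :=
      Gamma_add_one _ hna
    have eb : Gamma (α - I * β + 1 + n + 1) = (α - I * β + 1 + n) * Gamma (α - I * β + 1 + n) :=
      Gamma_add_one _ hnb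
    have ec : Gamma (2 * α + 1 + n + 1) = (2 * α + 1 + n) * Gamma (2 * α + 1 + n) :=
      Gamma_add_one _ hnc
    have e1 := one_div_Gamma_eq_self_mul_one_div_Gamma_add_one (α + I * β + 1 + n - k)
    have e2 := one_div_Gamma_eq_self_mul_one_div_Gamma_add_one (α - I * β + k)
    have hU := (ih (k - 1)).1
    have hV := (ih k).2
    have hU' : (∏ i ∈ Finset.range n, ((i : ℂ) - ((k - 1 : ℤ) : ℂ)))
        = ∏ i ∈ Finset.range n, ((i : ℂ) + 1 - k) :=
      Finset.prod_congr rfl fun i _ => by push_cast; ring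
    rw [hU', zpow_sub_one₀ (by norm_num)] at hU
    push_cast at hU
    rw [show (α + I * β + 1 + n - (k - 1) : ℂ) = α + I * β + 1 + n - k + 1 by ring,
      show (α - I * β + 1 + (k - 1) : ℂ) = α - I * β + k by ring, e2,
      show (α - I * β + k + 1 : ℂ) = α - I * β + 1 + k by ring] at hU
    rw [e1] at hV
    have hP : (∏ i ∈ Finset.range (n + 1), ((i : ℂ) - k))
        = (∏ i ∈ Finset.range n, ((i : ℂ) + 1 - k)) * (-k) := by
      rw [Finset.prod_range_succ']; push_cast; ring
    have hP' : (∏ i ∈ Finset.range (n + 1), ((i : ℂ) + 1 - k))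
        = (∏ i ∈ Finset.range n, ((i : ℂ) + 1 - k)) * (n + 1 - k) := by
      rw [Finset.prod_range_succ]
    rw [szegoPair, monomialPairing_add_C_mul hα, monomialPairing_add_C_mul hα,
      monomialPairing_X_mul, hU, hV, hP, hP', reflectionCoeff, reflectionCoeff]
    push_cast
    rw [← add_assoc, ← add_assoc, ← add_assoc, ea, eb, ec,
      show (α + I * β + 1 + n + 1 - k : ℂ) = α + I * β + 1 + n - k + 1 by ring]
    generalize (Gamma (α + I * β + 1 + n - k + 1))⁻¹ = g1
    generalize (Gamma (α - I * β + 1 + k))⁻¹ = g2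
    generalize (∏ i ∈ Finset.range n, ((i : ℂ) + 1 - k)) = P
    generalize ((-1 : ℂ) ^ k) = S
    generalize Gamma (α + I * β + 1 + n) = A at *
    generalize Gamma (α - I * β + 1 + n) = B at *
    generalize Gamma (α + I * β + 1) = A0 at *
    generalize Gamma (α - I * β + 1) = B0 at *
    generalize Gamma (2 * α + 1 + n) = G at *
    clear hU hV ih e1 e2
    constructor
    · field_simp
      ring
    · field_simp
      ring

/-- The squared norm of the monic orthogonal polynomial of degree `n`. -/
noncomputable def monicNormSq (α β : ℝ) (n : ℕ) : ℝ :=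
  2 * Real.pi * (n.factorial * Real.Gamma (2 * α + 1 + n)) / normSq (Gamma (α + I * β + 1 + n))

lemma Gamma_natCast_conj_ne_zero {α : ℝ} (hα : -1 / 2 < α) (β : ℝ) (n : ℕ) :
    Gamma (α + I * β + 1 + n) ≠ 0 := by
  have hn : (0 : ℝ) ≤ n := n.cast_nonneg
  exact Gamma_ne_zero_of_re_pos (by simp; linarith)

lemma monicNormSq_pos {α : ℝ} (hα : -1 / 2 < α) (β : ℝ) (n : ℕ) : 0 < monicNormSq α β n := by
  have hn : (0 : ℝ) ≤ n := n.cast_nonneg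
  have h1 := Real.Gamma_pos_of_pos (s := 2 * α + 1 + n) (by linarith)
  have h2 := normSq_pos.2 (Gamma_natCast_conj_ne_zero hα β n)
  unfold monicNormSq
  positivity

lemma ofReal_monicNormSq (α β : ℝ) (n : ℕ) :
    (monicNormSq α β n : ℂ) = 2 * Real.pi * (n.factorial * Gamma (2 * α + 1 + n))
      / (Gamma (α + I * β + 1 + n) * Gamma (α - I * β + 1 + n)) := by
  have h : Gamma (α - I * β + 1 + n) = (starRingEnd ℂ) (Gamma (α + I * β + 1 + n)) := by
    rw [← Gamma_conj]; congr 1; simp [sub_eq_add_neg]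
  rw [monicNormSq, h, mul_conj]
  push_cast [← Gamma_ofReal]
  rfl

lemma monomialPairing_szegoPair_of_lt {α : ℝ} (hα : -1 / 2 < α) (β : ℝ) {n k : ℕ} (h : k < n) :
    monomialPairing α β (szegoPair (α + I * β) (α - I * β) n).1 k = 0 := by
  rw [(monomialPairing_szegoPair hα β n k).1,
    Finset.prod_eq_zero (Finset.mem_range.2 h) (by simp)]
  simp

lemma monomialPairing_szegoPair_self {α : ℝ} (hα : -1 / 2 < α) (β : ℝ) (n : ℕ) :
    monomialPairing α β (szegoPair (α + I * β) (α - I * β) n).1 n = monicNormSq α β n := by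
  have hP : (∏ i ∈ Finset.range n, ((i : ℂ) - n)) = (-1) ^ n * n.factorial := by
    rw [← Finset.prod_range_reflect, ← Finset.prod_range_add_one_eq_factorial]
    push_cast
    rw [← Finset.card_range n, ← Finset.prod_const, Finset.card_range,
      ← Finset.prod_mul_distrib]
    refine Finset.prod_congr rfl fun i hi => ?_
    have := Finset.mem_range.1 hi
    rw [show n - 1 - i = n - (i + 1) by omega, Nat.cast_sub (by omega)]
    push_cast; ring
  have hs : ((-1 : ℂ) ^ n) * (-1) ^ n = 1 := by rw [← mul_pow]; simp
  have hG := Gamma_natCast_conj_ne_zero hα β 0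
  rw [Nat.cast_zero, add_zero] at hG
  rw [(monomialPairing_szegoPair hα β n n).1, ofReal_monicNormSq]
  push_cast
  rw [hP, zpow_natCast, add_sub_cancel_right]
  field_simp
  linear_combination (Gamma (2 * α + 1 + n) * n.factorial
    * (Gamma (α + I * β + 1 + n))⁻¹ * (Gamma (α - I * β + 1 + n))⁻¹) * hs

/-! ### Orthonormal polynomials for a general sesquilinear form. -/

/-- `φ` is a sequence of orthonormal polynomials, of exact degrees and with positive leading
coefficients, for the sesquilinear form `B`. -/
structure IsOrthonormalFor (B : Polynomial ℂ →ₗ[ℂ] Polynomial ℂ →ₗ⋆[ℂ] ℂ)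
    (φ : ℕ → Polynomial ℂ) : Prop where
  natDegree_eq : ∀ n, (φ n).natDegree = n
  leadingCoeff_re_pos : ∀ n, 0 < (φ n).leadingCoeff.re
  leadingCoeff_im_eq_zero : ∀ n, (φ n).leadingCoeff.im = 0
  orthonormal : ∀ m n, B (φ m) (φ n) = if m = n then 1 else 0

namespace IsOrthonormalFor

variable {B : Polynomial ℂ →ₗ[ℂ] Polynomial ℂ →ₗ⋆[ℂ] ℂ} {φ ψ : ℕ → Polynomial ℂ}

lemma leadingCoeff_ne_zero (h : IsOrthonormalFor B φ) (n : ℕ) : (φ n).leadingCoeff ≠ 0 := by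
  intro h0
  have := h.leadingCoeff_re_pos n
  rw [h0] at this
  simp at this

lemma coeff_self (h : IsOrthonormalFor B φ) (n : ℕ) :
    (φ n).coeff n = (φ n).leadingCoeff := by
  rw [Polynomial.leadingCoeff, h.natDegree_eq]

lemma coeff_eq_zero (h : IsOrthonormalFor B φ) {n k : ℕ} (hk : n < k) : (φ n).coeff k = 0 :=
  Polynomial.coeff_eq_zero_of_natDegree_lt (by rwa [h.natDegree_eq])

/-- One elimination step of the expansion in the `φ_k`. Bounding degrees by vanishing coefficients
treats the zero polynomial and the bound `0` uniformly. -/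
lemma exists_decomposition (h : IsOrthonormalFor B φ) {k : ℕ} {p : Polynomial ℂ}
    (hp : ∀ m, k + 1 ≤ m → p.coeff m = 0) :
    ∃ (c : ℂ) (q : Polynomial ℂ), p = c • φ k + q ∧ ∀ m, k ≤ m → q.coeff m = 0 := by
  refine ⟨p.coeff k / (φ k).leadingCoeff, p - (p.coeff k / (φ k).leadingCoeff) • φ k,
    by ring, fun m hm => ?_⟩
  rw [Polynomial.coeff_sub, Polynomial.coeff_smul, smul_eq_mul]
  rcases hm.eq_or_lt with rfl | hlt
  · rw [h.coeff_self, div_mul_cancel₀ _ (h.leadingCoeff_ne_zero k), sub_self]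
  · rw [hp m hlt, h.coeff_eq_zero hlt, mul_zero, sub_zero]

lemma left_eq_zero (h : IsOrthonormalFor B φ) {n : ℕ} (k : ℕ) (hk : k ≤ n) :
    ∀ p : Polynomial ℂ, (∀ m, k ≤ m → p.coeff m = 0) → B p (φ n) = 0 := by
  induction k with
  | zero =>
    intro p hp
    have : p = 0 := Polynomial.ext fun m => by simpa using hp m m.zero_le
    simp [this]
  | succ k ih =>
    intro p hp
    obtain ⟨c, q, rfl, hq⟩ := h.exists_decomposition hp
    rw [map_add, map_smul, LinearMap.add_apply, LinearMap.smul_apply, h.orthonormal,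
      if_neg (by omega), ih (by omega) q hq]
    simp

lemma right_eq_zero (h : IsOrthonormalFor B φ)
    (hB : ∀ p q, B q p = (starRingEnd ℂ) (B p q)) {n : ℕ} (p : Polynomial ℂ)
    (hp : ∀ m, n ≤ m → p.coeff m = 0) : B (φ n) p = 0 := by
  rw [hB p, h.left_eq_zero n le_rfl p hp, map_zero]

/-- Expansion in the `φ_i` replaces positive definiteness of `B`, which is not assumed: pairing with
the top `φ_n` reads off its coefficient. -/
lemma eq_zero_of_orthogonal (h : IsOrthonormalFor B φ) (n : ℕ) :
    ∀ p : Polynomial ℂ, (∀ m, n ≤ m → p.coeff m = 0) → (∀ i < n, B p (φ i) = 0) → p = 0 := by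
  induction n with
  | zero => exact fun p hp _ => Polynomial.ext fun m => by simpa using hp m m.zero_le
  | succ n ih =>
    intro p hp ho
    obtain ⟨c, q, rfl, hq⟩ := h.exists_decomposition hp
    have h0 := ho n n.lt_succ_self
    rw [map_add, map_smul, LinearMap.add_apply, LinearMap.smul_apply, h.orthonormal, if_pos rfl,
      h.left_eq_zero n le_rfl q hq] at h0
    have hc : c = 0 := by simpa using h0
    rw [hc, zero_smul, zero_add]
    refine ih q hq fun i hi => ?_
    have := ho i (by omega)
    rwa [hc, zero_smul, zero_add] at this

/-- Matching leading coefficients makes `φ_n - t ψ_n` of lower degree and orthogonal to every `φ_i`,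
`i < n`, hence zero. Then `t > 0`, and normalization gives `t² = 1`. -/
lemma unique (hφ : IsOrthonormalFor B φ) (hψ : IsOrthonormalFor B ψ)
    (hB : ∀ p q, B q p = (starRingEnd ℂ) (B p q)) : φ = ψ := by
  funext n
  set t : ℂ := (φ n).leadingCoeff / (ψ n).leadingCoeff with ht
  have hcoeff : ∀ {i m : ℕ}, i < n → n ≤ m → (φ i).coeff m = 0 := fun hi hm =>
    hφ.coeff_eq_zero (by omega)
  have hd : φ n - t • ψ n = 0 := by
    refine hφ.eq_zero_of_orthogonal n _ (fun m hm => ?_) fun i hi => ?_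
    · rw [Polynomial.coeff_sub, Polynomial.coeff_smul, smul_eq_mul]
      rcases hm.eq_or_lt with rfl | hlt
      · rw [hφ.coeff_self, hψ.coeff_self, ht, div_mul_cancel₀ _ (hψ.leadingCoeff_ne_zero _),
          sub_self]
      · rw [hφ.coeff_eq_zero hlt, hψ.coeff_eq_zero hlt, mul_zero, sub_zero]
    · rw [map_sub, map_smul, LinearMap.sub_apply, LinearMap.smul_apply,
        hφ.right_eq_zero hB _ fun m hm => hcoeff hi hm,
        hψ.right_eq_zero hB _ fun m hm => hcoeff hi hm]
      simp
  have hφt : φ n = t • ψ n := sub_eq_zero.1 hd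
  have hreal : ∀ {χ : ℕ → Polynomial ℂ}, IsOrthonormalFor B χ →
      (χ n).leadingCoeff = ((χ n).leadingCoeff.re : ℂ) := fun h =>
    Complex.ext (by simp) (by simpa using h.leadingCoeff_im_eq_zero n)
  obtain ⟨s, hs, hts⟩ : ∃ s : ℝ, 0 < s ∧ t = s := by
    refine ⟨(φ n).leadingCoeff.re / (ψ n).leadingCoeff.re,
      div_pos (hφ.leadingCoeff_re_pos n) (hψ.leadingCoeff_re_pos n), ?_⟩
    rw [ht, hreal hφ, hreal hψ]; push_cast; rfl
  have h1 := hφ.orthonormal n n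
  rw [hφt, B.map_smul, LinearMap.smul_apply, map_smulₛₗ, hψ.orthonormal, if_pos rfl, hts] at h1
  simp only [conj_ofReal, smul_eq_mul, mul_one] at h1
  have h2 : s * s = 1 := by exact_mod_cast h1
  have h3 : s = 1 := by nlinarith
  rw [hφt, hts, h3]; simp

open Matrix in
/-- The Gram determinant of the monomials. -/
lemma det_gram (h : IsOrthonormalFor B φ) (n : ℕ) :
    (Matrix.of fun j k : Fin n => B (Polynomial.X ^ (k : ℕ)) (Polynomial.X ^ (j : ℕ))).det
      = ∏ j ∈ Finset.range n, 1 / (φ j).leadingCoeff ^ 2 := by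
  set G : Matrix (Fin n) (Fin n) ℂ :=
    Matrix.of fun j k : Fin n => B (Polynomial.X ^ (k : ℕ)) (Polynomial.X ^ (j : ℕ)) with hG
  set A : Matrix (Fin n) (Fin n) ℂ := Matrix.of fun m j : Fin n => (φ m).coeff j with hA
  have hexp : ∀ m : Fin n,
      φ m = ∑ j : Fin n, (φ m).coeff j • (Polynomial.X : Polynomial ℂ) ^ (j : ℕ) := fun m => by
      have := Polynomial.as_sum_range' (φ m) n (by rw [h.natDegree_eq]; exact m.2)
      rw [← Fin.sum_univ_eq_sum_range
        (fun j => Polynomial.monomial j ((φ m).coeff j))] at this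
      conv_lhs => rw [this]
      exact Finset.sum_congr rfl fun j _ => by
        rw [← Polynomial.C_mul_X_pow_eq_monomial, Polynomial.smul_eq_C_mul]
  -- Orthonormality in matrix form. The transpose appears because the row index of `G` belongs to
  -- the second, conjugate-linear slot.
  have hAGA : A * Gᵀ * Aᴴ = 1 := by
    ext m l
    have hml := h.orthonormal m l
    rw [hexp m, hexp l] at hml
    simp only [map_sum, map_smul, LinearMap.sum_apply, LinearMap.smul_apply, map_smulₛₗ,
      smul_eq_mul] at hml
    rw [Matrix.one_apply, Matrix.mul_apply]
    simp only [Matrix.mul_apply, Matrix.transpose_apply, Matrix.conjTranspose_apply, hG, hA,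
      Matrix.of_apply]
    simp only [Fin.ext_iff]
    rw [← hml, Finset.sum_congr rfl fun x _ => Finset.sum_mul _ _ _]
    refine Finset.sum_congr rfl fun x _ => ?_
    rw [Finset.mul_sum]
    refine Finset.sum_congr rfl fun y _ => ?_
    rw [starRingEnd_apply]; ring
  have hdetA : A.det = ∏ j ∈ Finset.range n, (φ j).leadingCoeff := by
    rw [Matrix.det_of_isLowerTriangular]
    · rw [← Fin.prod_univ_eq_prod_range (fun j => (φ j).leadingCoeff)]
      exact Finset.prod_congr rfl fun j _ => by rw [hA, Matrix.of_apply, h.coeff_self]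
    · intro i j hij
      exact h.coeff_eq_zero (by simpa using hij)
  have hstar : star A.det = A.det := by
    rw [hdetA, star_prod]
    refine Finset.prod_congr rfl fun j _ => ?_
    exact Complex.ext (by simp) (by simp [h.leadingCoeff_im_eq_zero])
  have hdet := congrArg Matrix.det hAGA
  rw [Matrix.det_mul, Matrix.det_mul, Matrix.det_transpose, Matrix.det_conjTranspose, hstar,
    Matrix.det_one] at hdet
  have hA0 : A.det ≠ 0 := by
    rw [hdetA]; exact Finset.prod_ne_zero_iff.2 fun j _ => h.leadingCoeff_ne_zero j
  rw [Finset.prod_div_distrib, Finset.prod_const_one, Finset.prod_pow, ← hdetA]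
  field_simp
  linear_combination hdet

/-- Normalizing monic orthogonal polynomials of positive squared norm. -/
lemma of_monic (hB : ∀ p q, B q p = (starRingEnd ℂ) (B p q)) {Φ : ℕ → Polynomial ℂ} {h : ℕ → ℝ}
    (hmonic : ∀ n, (Φ n).Monic) (hdeg : ∀ n, (Φ n).natDegree = n)
    (hlt : ∀ n k, k < n → B (Φ n) (Polynomial.X ^ k) = 0)
    (hself : ∀ n, B (Φ n) (Polynomial.X ^ n) = h n) (hpos : ∀ n, 0 < h n) :
    IsOrthonormalFor B fun n => (((√(h n))⁻¹ : ℝ) : ℂ) • Φ n := by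
  have hsq : ∀ n, 0 < √(h n) := fun n => Real.sqrt_pos.2 (hpos n)
  -- Only the top term `X^m` of the monic `Φ m` can pair nontrivially with `Φ n`, since lower powers
  -- are orthogonal to it.
  have hlow : ∀ m n, m ≤ n → B (Φ n) (Φ m) = if m = n then (h n : ℂ) else 0 := fun m n hmn => by
    rw [(hmonic m).as_sum, hdeg, map_add, map_sum, Finset.sum_eq_zero, add_zero]
    · rcases hmn.eq_or_lt with rfl | hlt'
      · rw [if_pos rfl, hself]
      · rw [if_neg hlt'.ne, hlt _ _ hlt']
    · intro k hk
      rw [← Polynomial.smul_eq_C_mul, map_smulₛₗ,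
        hlt n k (lt_of_lt_of_le (Finset.mem_range.1 hk) hmn), smul_zero]
  have hall : ∀ m n, B (Φ m) (Φ n) = if m = n then (h n : ℂ) else 0 := fun m n => by
    rcases le_total n m with hnm | hnm
    · rw [hlow n m hnm]
      by_cases e : m = n
      · simp [e]
      · rw [if_neg e, if_neg (Ne.symm e)]
    · rw [hB (Φ n), hlow m n hnm]
      split_ifs <;> simp
  have hlead : ∀ n, ((((√(h n))⁻¹ : ℝ) : ℂ) • Φ n).leadingCoeff = ((√(h n))⁻¹ : ℝ) := fun n => by
    rw [Polynomial.leadingCoeff_smul_of_smul_regular _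
      (IsSMulRegular.of_ne_zero (by exact_mod_cast (inv_pos.2 (hsq n)).ne')),
      (hmonic n).leadingCoeff, smul_eq_mul, mul_one]
  refine ⟨fun n => ?_, fun n => ?_, fun n => ?_, fun m n => ?_⟩
  · rw [Polynomial.natDegree_smul _ (by exact_mod_cast (inv_pos.2 (hsq n)).ne'), hdeg]
  · rw [hlead, ofReal_re]; exact inv_pos.2 (hsq n)
  · rw [hlead, ofReal_im]
  · rw [B.map_smul, LinearMap.smul_apply, map_smulₛₗ, hall]
    split_ifs with e
    · subst e
      simp only [conj_ofReal, smul_eq_mul]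
      norm_cast
      have := Real.mul_self_sqrt (hpos m).le
      have := (hsq m).ne'
      field_simp
      nlinarith
    · simp

end IsOrthonormalFor

/-! ### The Hermitian form of the weight and its Gram (Toeplitz) determinants. -/

lemma intervalIntegrable_eval_mul_conj_eval {α : ℝ} (hα : -1 / 2 < α) (β : ℝ)
    (p q : Polynomial ℂ) :
    IntervalIntegrable (fun θ : ℝ => p.eval (exp (θ * I))
      * (starRingEnd ℂ) (q.eval (exp (θ * I))) * (circleWeight α β θ : ℂ)) volume 0
      (2 * Real.pi) :=
  intervalIntegrable_mul_circleWeight hα β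
    ((continuous_eval_exp_mul_I p).mul (continuous_conj.comp (continuous_eval_exp_mul_I q)))

/-- The form `(p, q) ↦ c ∫ p(z) conj(q(z)) |1 - z|^{2α} e^{-β(θ - π)} dθ`. -/
noncomputable def weightForm (c : ℝ) {α : ℝ} (hα : -1 / 2 < α) (β : ℝ) :
    Polynomial ℂ →ₗ[ℂ] Polynomial ℂ →ₗ⋆[ℂ] ℂ :=
  LinearMap.mk₂'ₛₗ (RingHom.id ℂ) (starRingEnd ℂ)
    (fun p q => (c : ℂ) * ∫ θ in (0 : ℝ)..2 * Real.pi, p.eval (exp (θ * I))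
      * (starRingEnd ℂ) (q.eval (exp (θ * I))) * (circleWeight α β θ : ℂ))
    (fun p p' q => by
      rw [← mul_add, ← intervalIntegral.integral_add
        (intervalIntegrable_eval_mul_conj_eval hα β p q)
        (intervalIntegrable_eval_mul_conj_eval hα β p' q)]
      congr 2; ext θ; rw [Polynomial.eval_add]; ring)
    (fun a p q => by
      rw [smul_eq_mul, mul_left_comm, RingHom.id_apply, ← intervalIntegral.integral_const_mul a]
      congr 2; ext θ; rw [Polynomial.eval_smul, smul_eq_mul]; ring)
    (fun p q q' => by
      rw [← mul_add, ← intervalIntegral.integral_add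
        (intervalIntegrable_eval_mul_conj_eval hα β p q)
        (intervalIntegrable_eval_mul_conj_eval hα β p q')]
      congr 2; ext θ; rw [Polynomial.eval_add, map_add]; ring)
    (fun a p q => by
      rw [smul_eq_mul, mul_left_comm,
        ← intervalIntegral.integral_const_mul ((starRingEnd ℂ) a)]
      congr 2; ext θ; rw [Polynomial.eval_smul, smul_eq_mul, map_mul]; ring)

lemma weightForm_apply (c : ℝ) {α : ℝ} (hα : -1 / 2 < α) (β : ℝ) (p q : Polynomial ℂ) :
    weightForm c hα β p q = (c : ℂ) * ∫ θ in (0 : ℝ)..2 * Real.pi, p.eval (exp (θ * I))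
      * (starRingEnd ℂ) (q.eval (exp (θ * I))) * (circleWeight α β θ : ℂ) := rfl

lemma weightForm_conj (c : ℝ) {α : ℝ} (hα : -1 / 2 < α) (β : ℝ) (p q : Polynomial ℂ) :
    weightForm c hα β q p = (starRingEnd ℂ) (weightForm c hα β p q) := by
  rw [weightForm_apply, weightForm_apply, map_mul, conj_ofReal,
    ← intervalIntegral.intervalIntegral_conj]
  congr 2
  ext θ
  rw [map_mul, map_mul, conj_conj, conj_ofReal]
  ring

lemma conj_exp_mul_I_pow (θ : ℝ) (k : ℕ) :
    (starRingEnd ℂ) (exp (θ * I) ^ k) = exp (θ * I) ^ (-(k : ℤ)) := by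
  rw [map_pow, ← exp_conj, map_mul, conj_ofReal, conj_I, mul_neg, exp_neg, zpow_neg,
    zpow_natCast, inv_pow]

lemma weightForm_X_pow_right (c : ℝ) {α : ℝ} (hα : -1 / 2 < α) (β : ℝ) (p : Polynomial ℂ)
    (k : ℕ) : weightForm c hα β p (Polynomial.X ^ k) = c * monomialPairing α β p k := by
  rw [weightForm_apply, monomialPairing]
  congr 2
  ext θ
  rw [Polynomial.eval_pow, Polynomial.eval_X, conj_exp_mul_I_pow]

lemma weightForm_X_pow (c : ℝ) {α : ℝ} (hα : -1 / 2 < α) (β : ℝ) (j k : ℕ) :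
    weightForm c hα β (Polynomial.X ^ k) (Polynomial.X ^ j)
      = c * circleMoment α β ((j : ℤ) - (k : ℤ)) := by
  rw [weightForm_apply, circleMoment]
  congr 2
  ext θ
  rw [Polynomial.eval_pow, Polynomial.eval_X, Polynomial.eval_pow, Polynomial.eval_X,
    conj_exp_mul_I_pow, ← zpow_natCast, ← zpow_add₀ (exp_ne_zero _)]
  ring_nf

lemma circleIntegral_eq_weightForm (c : ℝ) {α : ℝ} (hα : -1 / 2 < α) (β : ℝ)
    (p q : Polynomial ℂ) :
    (∮ z in C(0, 1), p.eval z * (starRingEnd ℂ) (q.eval z) * fisherHartwigSymbol c α β z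
      / (I * z)) = weightForm c hα β p q := by
  have h : (∮ z in C(0, 1), p.eval z * (starRingEnd ℂ) (q.eval z) * fisherHartwigSymbol c α β z
      / (I * z)) = ∮ z in C(0, 1), (p.eval z * (starRingEnd ℂ) (q.eval z) / (I * z))
        * fisherHartwigSymbol c α β z := by
    congr 1; ext z; ring
  rw [h, weightForm_apply]
  refine circleIntegral_eq_moment_integral c α β _ _ fun θ => ?_
  have h1 := exp_ne_zero ((θ : ℂ) * I)
  have h2 := I_ne_zero
  field_simp

lemma isOrthonormalPolynomials_iff (c : ℝ) {α : ℝ} (hα : -1 / 2 < α) (β : ℝ)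
    (φ : ℕ → Polynomial ℂ) :
    IsOrthonormalPolynomials (fisherHartwigSymbol c α β) φ
      ↔ IsOrthonormalFor (weightForm c hα β) φ := by
  constructor
  · rintro ⟨h1, h2, h3, h4⟩
    exact ⟨h1, h2, h3, fun m n => by rw [← circleIntegral_eq_weightForm, h4]⟩
  · rintro ⟨h1, h2, h3, h4⟩
    exact ⟨h1, h2, h3, fun m n => by rw [circleIntegral_eq_weightForm c hα, h4]⟩

lemma toeplitzDet_eq_prod_leadingCoeff (c : ℝ) {α : ℝ} (hα : -1 / 2 < α) (β : ℝ)
    {φ : ℕ → Polynomial ℂ} (h : IsOrthonormalFor (weightForm c hα β) φ) (n : ℕ) :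
    toeplitzDet (fisherHartwigSymbol c α β) n
      = ∏ j ∈ Finset.range n, 1 / (2 * Real.pi * (φ j).leadingCoeff ^ 2) := by
  have hM : (Matrix.of fun j k : Fin n =>
      symbolCoeff (fisherHartwigSymbol c α β) ((j : ℤ) - (k : ℤ)))
      = (2 * Real.pi : ℂ)⁻¹ • Matrix.of fun j k : Fin n =>
        weightForm c hα β (Polynomial.X ^ (k : ℕ)) (Polynomial.X ^ (j : ℕ)) := by
    ext j k
    rw [Matrix.of_apply, Matrix.smul_apply, Matrix.of_apply, weightForm_X_pow,
      symbolCoeff_fisherHartwigSymbol, smul_eq_mul]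
    ring
  rw [toeplitzDet, hM, Matrix.det_smul, h.det_gram, Fintype.card_fin]
  have : ((2 * Real.pi : ℂ)⁻¹) ^ n = ∏ _j ∈ Finset.range n, (2 * Real.pi : ℂ)⁻¹ := by simp
  rw [this, ← Finset.prod_mul_distrib]
  refine Finset.prod_congr rfl fun j _ => ?_
  rw [one_div, one_div, mul_inv (2 * (Real.pi : ℂ))]

/-- The normalized orthogonal polynomials of the weight. -/
noncomputable def orthonormalPolynomial (c α β : ℝ) (n : ℕ) : Polynomial ℂ :=
  (((√(c * monicNormSq α β n))⁻¹ : ℝ) : ℂ) • (szegoPair (α + I * β) (α - I * β) n).1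

lemma isOrthonormalFor_orthonormalPolynomial {c α : ℝ} (hc : 0 < c) (hα : -1 / 2 < α) (β : ℝ) :
    IsOrthonormalFor (weightForm c hα β) (orthonormalPolynomial c α β) := by
  refine IsOrthonormalFor.of_monic (weightForm_conj c hα β)
    (fun n => (szegoPair_degree _ _ n).1.1) (fun n => (szegoPair_degree _ _ n).1.2)
    (fun n k hk => ?_) (fun n => ?_) fun n => mul_pos hc (monicNormSq_pos hα β n)
  · rw [weightForm_X_pow_right, monomialPairing_szegoPair_of_lt hα β hk, mul_zero]
  · rw [weightForm_X_pow_right, monomialPairing_szegoPair_self hα]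
    push_cast; rfl

lemma leadingCoeff_orthonormalPolynomial_sq {c α : ℝ} (hc : 0 < c) (hα : -1 / 2 < α) (β : ℝ)
    (n : ℕ) : (orthonormalPolynomial c α β n).leadingCoeff ^ 2
      = ((c : ℂ) * monicNormSq α β n)⁻¹ := by
  have hpos : 0 < c * monicNormSq α β n := mul_pos hc (monicNormSq_pos hα β n)
  have hsq : (√(c * monicNormSq α β n))⁻¹ ≠ 0 := (inv_pos.2 (Real.sqrt_pos.2 hpos)).ne'
  rw [orthonormalPolynomial, Polynomial.leadingCoeff_smul_of_smul_regular _
      (IsSMulRegular.of_ne_zero (by exact_mod_cast hsq)),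
      (szegoPair_degree _ _ n).1.1.leadingCoeff, smul_eq_mul, mul_one, ← ofReal_pow, inv_pow,
      Real.sq_sqrt hpos.le]
  push_cast; rfl

/-! ### Barnes function form of the determinants and the main theorem. -/

/-- Passing from `n` to `n + 1` multiplies each `n`-dependent Barnes factor by a Gamma value, and
together these are the Gamma quotient in `monicNormSq`; at `n = 0` the right side collapses by `G(1)
= 1`. -/
lemma prod_monicNormSq_eq_barnesG (C : ℂ) {α : ℝ} (hα : -1 / 2 < α) (β : ℝ) (n : ℕ) :
    ∏ j ∈ Finset.range n, (C * monicNormSq α β j / (2 * Real.pi))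
      = C ^ n * (barnesG (n + 1) * barnesG (n + 2 * α + 1)
              * barnesG (α + I * β + 1) * barnesG (α - I * β + 1))
            / (barnesG (2 * α + 1) * barnesG (n + α + I * β + 1)
              * barnesG (n + α - I * β + 1)) := by
  have hpi : (Real.pi : ℂ) ≠ 0 := by exact_mod_cast Real.pi_ne_zero
  have g0 : barnesG (2 * α + 1) ≠ 0 := barnesG_ne_zero (by simp; linarith)
  induction n with
  | zero =>
    have g1 : barnesG (α + I * β + 1) ≠ 0 := barnesG_ne_zero (by simp; linarith)
    have g2 : barnesG (α - I * β + 1) ≠ 0 := barnesG_ne_zero (by simp; linarith)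
    simp only [Finset.range_zero, Finset.prod_empty, pow_zero, Nat.cast_zero, zero_add,
      barnesG_one, one_mul]
    field_simp
  | succ n ih =>
    have hn : (0 : ℝ) ≤ n := n.cast_nonneg
    have r1 : 0 < (n + α + I * β + 1 : ℂ).re := by simp; linarith
    have r2 : 0 < (n + α - I * β + 1 : ℂ).re := by simp; linarith
    have r3 : 0 < (n + 2 * α + 1 : ℂ).re := by simp; linarith
    have r4 : 0 < (n + 1 : ℂ).re := by simp; linarith
    have g1 := barnesG_ne_zero r1
    have g2 := barnesG_ne_zero r2
    have G1 := Gamma_ne_zero_of_re_pos r1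
    have G2 := Gamma_ne_zero_of_re_pos r2
    rw [Finset.prod_range_succ, ih, ofReal_monicNormSq]
    push_cast
    rw [barnesG_add_one r4,
      show (n + 1 + 2 * α + 1 : ℂ) = n + 2 * α + 1 + 1 by ring, barnesG_add_one r3,
      show (n + 1 + α + I * β + 1 : ℂ) = n + α + I * β + 1 + 1 by ring, barnesG_add_one r1,
      show (n + 1 + α - I * β + 1 : ℂ) = n + α - I * β + 1 + 1 by ring, barnesG_add_one r2,
      show (2 * α + 1 + n : ℂ) = n + 2 * α + 1 by ring,
      show (α + I * β + 1 + n : ℂ) = n + α + I * β + 1 by ring,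
      show (α - I * β + 1 + n : ℂ) = n + α - I * β + 1 by ring, Gamma_nat_eq_factorial, pow_succ]
    field_simp

theorem mainTheorem1 (α β : ℝ) (hα : -1 / 2 < α) :
    (∃! C : ℂ, symbolCoeff (fisherHartwigSymbol C α β) 0 = 1 / (2 * Real.pi)) ∧
    ∀ C : ℂ, symbolCoeff (fisherHartwigSymbol C α β) 0 = 1 / (2 * Real.pi) →
      (∃! φ : ℕ → Polynomial ℂ, IsOrthonormalPolynomials (fisherHartwigSymbol C α β) φ) ∧
      (∀ φ : ℕ → Polynomial ℂ, IsOrthonormalPolynomials (fisherHartwigSymbol C α β) φ →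
        ∀ n : ℕ, toeplitzDet (fisherHartwigSymbol C α β) n
          = ∏ j ∈ Finset.range n, 1 / (2 * Real.pi * (φ j).leadingCoeff ^ 2)) ∧
      ∀ n : ℕ, toeplitzDet (fisherHartwigSymbol C α β) n
        = C ^ n * (barnesG (n + 1) * barnesG (n + 2 * α + 1)
              * barnesG (α + I * β + 1) * barnesG (α - I * β + 1))
            / (barnesG (2 * α + 1) * barnesG (n + α + I * β + 1)
              * barnesG (n + α - I * β + 1)) := by
  have hJ := integral_circleWeight_pos hα β
  set J : ℝ := ∫ θ in (0 : ℝ)..2 * Real.pi, circleWeight α β θ with hJdef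
  have hJc : (J : ℂ) ≠ 0 := by exact_mod_cast hJ.ne'
  -- The condition is linear in `C`, namely `C J = 1`. Its solution is real and positive, as the
  -- Hermitian form and the square roots normalizing the polynomials need.
  have hC : ∀ C : ℂ, symbolCoeff (fisherHartwigSymbol C α β) 0 = 1 / (2 * Real.pi)
      ↔ C = ((J⁻¹ : ℝ) : ℂ) := fun C => by
    rw [symbolCoeff_fisherHartwigSymbol, circleMoment_zero_eq_ofReal, ← hJdef,
      div_left_inj' (by simp), ofReal_inv, ← one_div, eq_div_iff hJc]
  refine ⟨⟨_, (hC _).2 rfl, fun C h => (hC C).1 h⟩, fun C h => ?_⟩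
  rw [(hC C).1 h]
  have hc : 0 < J⁻¹ := inv_pos.2 hJ
  have hφ := isOrthonormalFor_orthonormalPolynomial hc hα β
  refine ⟨⟨_, (isOrthonormalPolynomials_iff _ hα β _).2 hφ, fun ψ hψ => ?_⟩,
    fun ψ hψ n => ?_, fun n => ?_⟩
  · exact ((isOrthonormalPolynomials_iff _ hα β ψ).1 hψ).unique hφ (weightForm_conj _ hα β)
  · exact toeplitzDet_eq_prod_leadingCoeff _ hα β
      ((isOrthonormalPolynomials_iff _ hα β ψ).1 hψ) n
  · rw [toeplitzDet_eq_prod_leadingCoeff _ hα β hφ, ← prod_monicNormSq_eq_barnesG _ hα]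
    refine Finset.prod_congr rfl fun j _ => ?_
    rw [leadingCoeff_orthonormalPolynomial_sq hc hα, one_div, mul_inv, inv_inv]
    ring
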